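/- Let $X$ be a finite-dimensional smooth real manifold (Hausdorff, second countable, without boundary), let $Y\to X$ and $E\to X$ be smooth real vector bundles of finite rank, and let $k\ge 0$ be an integer. Write $Y(X)$ and $E(X)$ for the $C^\infty(X)$-modules of smooth global sections, and $\mathcal D(Y)\subset Y(X)$ for the submodule of sections with compact support. For $C^\infty(X)$-modules $P,Q$ let $\mathrm{Diff}_k(P,Q)$ be the $C^\infty(X)$-module, with action $(f\Delta)(p)=f\,\Delta(p)$, of all $\mathbb R$-linear maps $\Delta:P\to Q$ such that $\delta_{f_0}\circ\cdots\circ\delta_{f_k}\Delta=0$ for all $f_0,\dots,f_k\in C^\infty(X)$, where $(\delta_f\Phi)(p)=f\,\Phi(p)-\Phi(fp)$. Then restriction of operators from $Y(X)$ to $\mathcal D(Y)$ is a one-to-one correspondence (an isomorphism of $C^\infty(X)$-modules) $$\mathrm{Diff}_k(Y(X),E(X))\;\longrightarrow\;\mathrm{Diff}_k(\mathcal D(Y),E(X)).$$ Moreover, let $J^kY\to X$ be the bundle of $k$-jets of sections of $Y$, and $j^k_xs$ the $k$-jet of a section $s$ at $x$, and identify the vector bundle $(J^kY)^*\otimes E$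 with $\mathrm{Hom}(J^kY,E)$. Then the formula $(\Delta_\sigma s)(x)=\sigma_x(j^k_xs)$ defines isomorphisms $\sigma\mapsto\Delta_\sigma$ of $C^\infty(X)$-modules $$((J^kY)^*\otimes E)(X)\cong\mathrm{Diff}_k(Y(X),E(X)),\qquad ((J^kY)^*\otimes E)(X)\cong\mathrm{Diff}_k(\mathcal D(Y),E(X)),$$ where in the second case $s$ runs through $\mathcal D(Y)$. -/

import Mathlib

open Bundle Manifold
open scoped ContDiff Topology Manifold

noncomputable section

section Calculus

universe u v
variable {E : Type u} {F : Type v} [NormedAddCommGroup E] [NormedSpace ℝ E]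
  [NormedAddCommGroup F] [NormedSpace ℝ F]

theorem iteratedFDeriv_swap_aux (n : ℕ) : ∀ {f : E → F} {x : E},
    ContDiffAt ℝ (n + 1 : ℕ) f x → ∀ (i : Fin n) (v : Fin (n + 1) → E),
    iteratedFDeriv ℝ (n + 1) f x (v ∘ Equiv.swap i.castSucc i.succ)
      = iteratedFDeriv ℝ (n + 1) f x v := by
  induction n with
  | zero => intro f x _ i; exact i.elim0
  | succ n ih =>
    intro f x hf i v
    refine Fin.cases ?_ (fun j => ?_) i
    · -- the first two entries: symmetry of a second derivative
      have h2 : ContDiffAt ℝ 2 (iteratedFDeriv ℝ n f) x := by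
        refine hf.iteratedFDeriv_right (m := 2) (i := n) ?_
        exact_mod_cast (by omega : 2 + n ≤ n + 1 + 1)
      have h3 : ContDiffAt ℝ (n + 1 : ℕ) f x := hf.of_le (by exact_mod_cast Nat.le_succ _)
      have hd : DifferentiableAt ℝ (iteratedFDeriv ℝ (n + 1) f) x := by
        refine (hf.iteratedFDeriv_right (m := 1) (i := n + 1) ?_).differentiableAt (by simp)
        exact_mod_cast (by omega : 1 + (n + 1) ≤ n + 1 + 1)
      have hg2 : ∀ u : Fin n → E, ContDiffAt ℝ 2 (fun y => iteratedFDeriv ℝ n f y u) x := fun u =>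
        (ContinuousMultilinearMap.apply ℝ (fun _ : Fin n => E) F u).contDiff.contDiffAt.comp x h2
      have key : ∀ w : Fin (n + 2) → E, iteratedFDeriv ℝ (n + 2) f x w
          = fderiv ℝ (fderiv ℝ (fun y => iteratedFDeriv ℝ n f y (fun a => w a.succ.succ))) x
              (w 0) (w 1) := by
        intro w
        rw [iteratedFDeriv_succ_apply_left, ← fderiv_continuousMultilinear_apply_const_apply hd]
        have hev : (fun y => iteratedFDeriv ℝ (n + 1) f y (Fin.tail w)) =ᶠ[𝓝 x]
            fun y => fderiv ℝ (fun y => iteratedFDeriv ℝ n f y (fun a => w a.succ.succ)) y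
              (w 1) := by
          filter_upwards [h3.eventually (by simp)] with y hy
          have hdy : DifferentiableAt ℝ (iteratedFDeriv ℝ n f) y := by
            refine (hy.iteratedFDeriv_right (m := 1) (i := n) ?_).differentiableAt (by simp)
            exact_mod_cast (by omega : 1 + n ≤ n + 1)
          rw [iteratedFDeriv_succ_apply_left, fderiv_continuousMultilinear_apply_const_apply hdy]
          rfl
        rw [hev.fderiv_eq]
        have hdd : DifferentiableAt ℝ
            (fderiv ℝ (fun y => iteratedFDeriv ℝ n f y (fun a => w a.succ.succ))) x :=
          ((hg2 _).fderiv_right (m := 1) (by norm_num)).differentiableAt (by simp)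
        rw [fderiv_clm_apply hdd (differentiableAt_const _)]
        simp
      rw [key, key]
      have e1 : (v ∘ Equiv.swap (Fin.castSucc (0 : Fin (n+1))) (Fin.succ 0)) 0 = v 1 := by
        simp
      have e2 : (v ∘ Equiv.swap (Fin.castSucc (0 : Fin (n+1))) (Fin.succ 0)) 1 = v 0 := by
        simp
      have e3 : (fun a : Fin n => (v ∘ Equiv.swap (Fin.castSucc (0 : Fin (n+1))) (Fin.succ 0))
          a.succ.succ) = fun a : Fin n => v a.succ.succ := by
        funext a
        simp only [Function.comp_apply]
        rw [Equiv.swap_apply_of_ne_of_ne]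
        · simp
        · intro h; simpa using Fin.succ_inj.1 h
      rw [e1, e2, e3, ((hg2 _).isSymmSndFDerivAt (by simp)).eq]
    · have hfd : ∀ᶠ y in 𝓝 x, ContDiffAt ℝ (n + 1 : ℕ) f y :=
        (hf.of_le (m := (n + 1 : ℕ)) (by exact_mod_cast Nat.le_succ _)).eventually (by simp)
      have hd : DifferentiableAt ℝ (iteratedFDeriv ℝ (n + 1) f) x := by
        refine (hf.iteratedFDeriv_right (m := 1) (i := n + 1) ?_).differentiableAt (by simp)
        exact_mod_cast (by omega : 1 + (n + 1) ≤ n + 1 + 1)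
      have key : ∀ w : Fin (n + 2) → E, iteratedFDeriv ℝ (n + 2) f x w
          = fderiv ℝ (fun y => iteratedFDeriv ℝ (n + 1) f y (Fin.tail w)) x (w 0) := by
        intro w
        rw [iteratedFDeriv_succ_apply_left, fderiv_continuousMultilinear_apply_const_apply hd]
      rw [key, key]
      have e0 : (v ∘ Equiv.swap (Fin.castSucc j.succ) (Fin.succ j.succ)) 0 = v 0 := by
        simp only [Function.comp_apply]
        rw [Equiv.swap_apply_of_ne_of_ne]
        · intro h; simpa using congrArg Fin.val h
        · intro h; simpa using congrArg Fin.val h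
      have e1 : Fin.tail (v ∘ Equiv.swap (Fin.castSucc j.succ) (Fin.succ j.succ))
          = Fin.tail v ∘ Equiv.swap j.castSucc j.succ := by
        funext a
        simp only [Fin.tail, Function.comp_apply]
        congr 1
        rw [show Fin.castSucc j.succ = Fin.succ j.castSucc from rfl]
        exact ((Fin.succ_injective _).swap_apply _ _ _)
      rw [e0, e1]
      congr 1
      refine Filter.EventuallyEq.fderiv_eq ?_
      filter_upwards [hfd] with y hy
      exact ih hy j (Fin.tail v)

theorem ContDiffAt.iteratedFDeriv_perm {f : E → F} {x : E} {n : ℕ} (hf : ContDiffAt ℝ n f x)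
    (σ : Equiv.Perm (Fin n)) (v : Fin n → E) :
    iteratedFDeriv ℝ n f x (v ∘ σ) = iteratedFDeriv ℝ n f x v := by
  cases n with
  | zero => congr 1; funext i; exact i.elim0
  | succ n =>
    have hσ : σ ∈ Submonoid.closure
        (Set.range fun i : Fin n => Equiv.swap i.castSucc i.succ) := by
      rw [Equiv.Perm.mclosure_swap_castSucc_succ]; trivial
    induction hσ using Submonoid.closure_induction generalizing v with
    | mem τ hτ => obtain ⟨i, rfl⟩ := hτ; exact iteratedFDeriv_swap_aux n hf i v
    | one => rfl
    | mul a b _ _ ha hb =>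
      rw [Equiv.Perm.coe_mul, ← Function.comp_assoc, hb, ha]

end Calculus

section Jets

variable {E F : Type*} [NormedAddCommGroup E] [NormedSpace ℝ E]
  [NormedAddCommGroup F] [NormedSpace ℝ F]

/-- The space of `k`-jets at a point of maps `E → F`: families `(T_0, …, T_k)` where `T_m` is a
symmetric `m`-linear map `E × ⋯ × E → F` (the candidate `m`-th derivative). -/
def jetSubmodule (k : ℕ) (E F : Type*) [NormedAddCommGroup E] [NormedSpace ℝ E]
    [NormedAddCommGroup F] [NormedSpace ℝ F] :
    Submodule ℝ (Π m : Fin (k + 1), E [×(m : ℕ)]→L[ℝ] F) where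
  carrier := {T | ∀ (m : Fin (k + 1)) (σ : Equiv.Perm (Fin m)) (v : Fin m → E),
    T m (v ∘ σ) = T m v}
  add_mem' ha hb m σ v := by
    simp [ha m σ v, hb m σ v]
  zero_mem' _ _ _ := rfl
  smul_mem' c T hT m σ v := by
    simp [hT m σ v]

/-- The space of `k`-jets at a point of maps `E → F`, as a normed space. -/
def JetModel (k : ℕ) (E F : Type*) [NormedAddCommGroup E] [NormedSpace ℝ E]
    [NormedAddCommGroup F] [NormedSpace ℝ F] : Type _ := jetSubmodule k E F

instance (k : ℕ) : NormedAddCommGroup (JetModel k E F) :=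
  inferInstanceAs (NormedAddCommGroup (jetSubmodule k E F))

instance (k : ℕ) : NormedSpace ℝ (JetModel k E F) :=
  inferInstanceAs (NormedSpace ℝ (jetSubmodule k E F))

theorem JetModel.ext {k : ℕ} {S T : JetModel k E F} (h : ∀ m, S.1 m = T.1 m) : S = T :=
  Subtype.ext (funext h)

theorem JetModel.add_coe {k : ℕ} (S T : JetModel k E F) (m : Fin (k + 1)) :
    (S + T).1 m = S.1 m + T.1 m := rfl

theorem JetModel.smul_coe {k : ℕ} (c : ℝ) (T : JetModel k E F) (m : Fin (k + 1)) :
    (c • T).1 m = c • T.1 m := rfl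

/-- The jet of `f` at `p`: the family of derivatives of order `0, …, k` of `f` at `p`
(junk value `0` if `f` is not `k` times continuously differentiable at `p`). -/
def jetAt (k : ℕ) (f : E → F) (p : E) : JetModel k E F :=
  open Classical in
  if h : ContDiffAt ℝ k f p then
    ⟨fun m => iteratedFDeriv ℝ m f p, fun m σ v =>
      (h.of_le (m := ((m : ℕ) : WithTop ℕ∞))
        (by exact_mod_cast Nat.lt_succ_iff.1 m.2)).iteratedFDeriv_perm σ v⟩
  else 0

/-- The Taylor polynomial `y ↦ ∑ T_m (y - p, …, y - p) / m!` of the jet `T` placed at `p`. -/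
def jetTaylor {k : ℕ} (T : JetModel k E F) (p : E) (y : E) : F :=
  ∑ m : Fin (k + 1), ((m : ℕ).factorial : ℝ)⁻¹ • T.1 m (fun _ => y - p)

theorem jetAt_coe {k : ℕ} {f : E → F} {p : E} (h : ContDiffAt ℝ k f p) (m : Fin (k + 1)) :
    (jetAt k f p).1 m = iteratedFDeriv ℝ m f p := by
  simp [jetAt, h]

theorem jetAt_eq_iff {k : ℕ} {f g : E → F} {p : E} (hf : ContDiffAt ℝ k f p)
    (hg : ContDiffAt ℝ k g p) :
    jetAt k f p = jetAt k g p ↔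
      ∀ m ≤ k, iteratedFDeriv ℝ m f p = iteratedFDeriv ℝ m g p := by
  constructor
  · intro h m hm
    have := congrArg (fun T : JetModel k E F => T.1 ⟨m, Nat.lt_succ_of_le hm⟩) h
    simpa only [jetAt_coe hf, jetAt_coe hg] using this
  · intro h
    refine JetModel.ext fun m => ?_
    rw [jetAt_coe hf, jetAt_coe hg]
    exact h m (Nat.lt_succ_iff.1 m.2)

theorem jetAt_congr {k : ℕ} {f g : E → F} {p : E} (h : f =ᶠ[𝓝 p] g) :
    jetAt k f p = jetAt k g p := by
  by_cases hf : ContDiffAt ℝ k f p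
  · have hg : ContDiffAt ℝ k g p := hf.congr_of_eventuallyEq h.symm
    rw [jetAt_eq_iff hf hg]
    exact fun m _ => (h.iteratedFDeriv ℝ m).eq_of_nhds
  · have hg : ¬ ContDiffAt ℝ k g p := fun hg => hf (hg.congr_of_eventuallyEq h)
    simp [jetAt, hf, hg]

theorem jetAt_add {k : ℕ} {f g : E → F} {p : E} (hf : ContDiffAt ℝ k f p)
    (hg : ContDiffAt ℝ k g p) : jetAt k (fun y => f y + g y) p = jetAt k f p + jetAt k g p := by
  refine JetModel.ext fun m => ?_
  have hm : ((m : ℕ) : WithTop ℕ∞) ≤ k := by exact_mod_cast Nat.lt_succ_iff.1 m.2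
  have := iteratedFDeriv_add_apply (hf.of_le hm) (hg.of_le hm)
  rw [jetAt_coe (hf.add hg)]
  simp only [JetModel.add_coe, jetAt_coe hf, jetAt_coe hg]
  exact this

theorem jetAt_smul {k : ℕ} {f : E → F} {p : E} (c : ℝ) (hf : ContDiffAt ℝ k f p) :
    jetAt k (fun y => c • f y) p = c • jetAt k f p := by
  refine JetModel.ext fun m => ?_
  have hm : ((m : ℕ) : WithTop ℕ∞) ≤ k := by exact_mod_cast Nat.lt_succ_iff.1 m.2
  have := iteratedFDeriv_const_smul_apply (a := c) (hf.of_le hm)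
  rw [jetAt_coe (hf.const_smul c)]
  simp only [JetModel.smul_coe, jetAt_coe hf]
  exact this

theorem contDiff_jetTaylor {k : ℕ} {n : WithTop ℕ∞} (T : JetModel k E F) :
    ContDiff ℝ n (fun q : E × E => jetTaylor T q.1 q.2) := by
  unfold jetTaylor
  refine ContDiff.sum fun m _ => ContDiff.const_smul _ ?_
  refine (ContinuousMultilinearMap.contDiff (T.1 m)).comp ?_
  exact contDiff_pi.2 fun _ => contDiff_snd.sub contDiff_fst

theorem contDiff_jetTaylor' {k : ℕ} {n : WithTop ℕ∞} (T : JetModel k E F) (p : E) :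
    ContDiff ℝ n (jetTaylor T p) :=
  (contDiff_jetTaylor T).comp (contDiff_const.prodMk contDiff_id)

theorem jetTaylor_add {k : ℕ} (S T : JetModel k E F) (p y : E) :
    jetTaylor (S + T) p y = jetTaylor S p y + jetTaylor T p y := by
  simp [jetTaylor, JetModel.add_coe, Finset.sum_add_distrib]

theorem jetTaylor_smul {k : ℕ} (c : ℝ) (T : JetModel k E F) (p y : E) :
    jetTaylor (c • T) p y = c • jetTaylor T p y := by
  simp [jetTaylor, JetModel.smul_coe, Finset.smul_sum, smul_comm c]

/-- The jet of the Taylor polynomial of `T` is `T`. -/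
theorem jetAt_jetTaylor {k : ℕ} (T : JetModel k E F) (p : E) :
    jetAt k (jetTaylor T p) p = T := by
  let q : FormalMultilinearSeries ℝ E F := fun n =>
    if h : n < k + 1 then ((n.factorial : ℝ)⁻¹) • T.1 ⟨n, h⟩ else 0
  have hq : ∀ m : Fin (k + 1), q m = ((m : ℕ).factorial : ℝ)⁻¹ • T.1 m := fun m => by
    simp only [q, dif_pos m.2]
  have A : HasFiniteFPowerSeriesOnBall (jetTaylor T p) q p (k + 1) ⊤ := by
    apply HasFiniteFPowerSeriesOnBall.mk' _ (by simp)
    · intro y _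
      rw [Finset.sum_range]
      simp [jetTaylor, hq]
    · intro m hm
      simp only [q, dif_neg (not_lt.2 hm)]
  have han : AnalyticOn ℝ (jetTaylor T p) Set.univ :=
    ((contDiff_jetTaylor' (n := ω) T p).contDiffOn).analyticOn
  refine JetModel.ext fun m => ?_
  rw [jetAt_coe (contDiff_jetTaylor' T p).contDiffAt]
  ext v
  rw [A.toHasFPowerSeriesOnBall.iteratedFDeriv_eq_sum han]
  have hs : ∀ σ : Equiv.Perm (Fin m), T.1 m (fun i => v (σ i)) = T.1 m v := fun σ =>
    T.2 m σ v
  simp only [hq, _root_.smul_apply, hs]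
  rw [Finset.sum_const, Finset.card_univ, Fintype.card_perm, Fintype.card_fin,
    ← Nat.cast_smul_eq_nsmul ℝ, smul_smul, mul_inv_cancel₀ (by positivity), one_smul]

/-- The jet of `y ↦ G y (f (ψ y))` at `p` depends only on the jet of `f` at `ψ p`. -/
theorem jetAt_transform {E' F' : Type*} [NormedAddCommGroup E'] [NormedSpace ℝ E']
    [NormedAddCommGroup F'] [NormedSpace ℝ F'] {k : ℕ} {f g : E → F} {ψ : E' → E}
    {G : E' → F →L[ℝ] F'} {p : E'}
    (hf : ContDiffAt ℝ k f (ψ p)) (hg : ContDiffAt ℝ k g (ψ p)) (hψ : ContDiffAt ℝ k ψ p)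
    (hG : ContDiffAt ℝ k G p) (h : jetAt k f (ψ p) = jetAt k g (ψ p)) :
    jetAt k (fun y => G y (f (ψ y))) p = jetAt k (fun y => G y (g (ψ y))) p := by
  rw [jetAt_eq_iff hf hg] at h
  have hfψ : ContDiffAt ℝ k (f ∘ ψ) p := hf.comp p hψ
  have hgψ : ContDiffAt ℝ k (g ∘ ψ) p := hg.comp p hψ
  have comp_eq : ∀ m ≤ k, iteratedFDeriv ℝ m (f ∘ ψ) p = iteratedFDeriv ℝ m (g ∘ ψ) p := by
    intro m hm
    have hm' : ((m : ℕ) : WithTop ℕ∞) ≤ k := by exact_mod_cast hm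
    rw [iteratedFDeriv_comp hf hψ hm', iteratedFDeriv_comp hg hψ hm']
    refine Finset.sum_congr rfl fun c _ => ?_
    ext v
    simp only [FormalMultilinearSeries.compAlongOrderedFinpartition_apply, ftaylorSeries]
    rw [h _ (c.length_le.trans hm)]
  have hB : ContDiff ℝ k (fun q : (F →L[ℝ] F') × F => q.1 q.2) :=
    isBoundedBilinearMap_apply.contDiff
  have hGf := hG.prodMk hfψ
  have hGg := hG.prodMk hgψ
  have cf : ContDiffAt ℝ k (fun y => G y (f (ψ y))) p := hG.clm_apply hfψ
  have cg : ContDiffAt ℝ k (fun y => G y (g (ψ y))) p := hG.clm_apply hgψ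
  rw [jetAt_eq_iff cf cg]
  intro m hm
  have hm' : ((m : ℕ) : WithTop ℕ∞) ≤ k := by exact_mod_cast hm
  have e1 : (fun y => G y (f (ψ y))) =
      (fun q : (F →L[ℝ] F') × F => q.1 q.2) ∘ (fun y => (G y, (f ∘ ψ) y)) := rfl
  have e2 : (fun y => G y (g (ψ y))) =
      (fun q : (F →L[ℝ] F') × F => q.1 q.2) ∘ (fun y => (G y, (g ∘ ψ) y)) := rfl
  rw [e1, e2, iteratedFDeriv_comp hB.contDiffAt hGf hm', iteratedFDeriv_comp hB.contDiffAt hGg hm']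
  refine Finset.sum_congr rfl fun c _ => ?_
  have ep : (f ∘ ψ) p = (g ∘ ψ) p := by
    have := comp_eq 0 (Nat.zero_le _)
    simpa using congrArg (fun L => L (fun i => i.elim0)) this
  ext v
  simp only [FormalMultilinearSeries.compAlongOrderedFinpartition_apply, ftaylorSeries]
  rw [ep]
  congr 1
  funext i
  simp only [OrderedFinpartition.applyOrderedFinpartition_apply]
  have hi : ((c.partSize i : ℕ) : WithTop ℕ∞) ≤ k := by
    exact_mod_cast (c.partSize_le i).trans hm
  rw [iteratedFDeriv_prodMk hG hfψ hi, iteratedFDeriv_prodMk hG hgψ hi,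
    comp_eq _ ((c.partSize_le i).trans hm)]

set_option synthInstance.maxHeartbeats 200000 in
/-- Derivatives in one variable of a smooth function of two variables are jointly smooth. -/
theorem contDiffAt_iteratedFDeriv_param {P : Type*} [NormedAddCommGroup P] [NormedSpace ℝ P]
    {Φ : P → E → F} {a : P} {p : E} (h : ContDiffAt ℝ ∞ (Function.uncurry Φ) (a, p)) (m : ℕ) :
    ContDiffAt ℝ ∞ (fun q : P × E => iteratedFDeriv ℝ m (Φ q.1) q.2) (a, p) := by
  induction m with
  | zero =>
    exact h.continuousLinearMap_comp
      ((continuousMultilinearCurryFin0 ℝ E F).symm : _ →L[ℝ] E [×0]→L[ℝ] F)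
  | succ m ih =>
    have key : ContDiffAt ℝ ∞
        (fun q : P × E => fderiv ℝ (fun z => iteratedFDeriv ℝ m (Φ q.1) z) q.2) (a, p) := by
      refine ContDiffAt.fderiv (n := ∞)
        (f := fun (q : P × E) z => iteratedFDeriv ℝ m (Φ q.1) z) ?_ contDiffAt_snd (by simp)
      exact ContDiffAt.comp (g := fun q : P × E => iteratedFDeriv ℝ m (Φ q.1) q.2)
        (f := fun q : (P × E) × E => (q.1.1, q.2)) ((a, p), p) ih
        ((contDiff_fst.comp contDiff_fst).prodMk contDiff_snd).contDiffAt
    exact key.continuousLinearMap_comp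
      ((continuousMultilinearCurryLeftEquiv ℝ (fun _ : Fin (m + 1) => E) F).symm :
        _ →L[ℝ] E [×(m + 1)]→L[ℝ] F)

theorem finiteDimensional_multilinear [FiniteDimensional ℝ E] [FiniteDimensional ℝ F] (m : ℕ) :
    FiniteDimensional ℝ (E [×m]→L[ℝ] F) :=
  Module.Finite.of_injective
    (ContinuousMultilinearMap.toMultilinearMapLinear :
      (E [×m]→L[ℝ] F) →ₗ[ℝ] MultilinearMap ℝ (fun _ : Fin m => E) F)
    ContinuousMultilinearMap.toMultilinearMap_injective

instance (k : ℕ) [FiniteDimensional ℝ E] [FiniteDimensional ℝ F] :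
    FiniteDimensional ℝ (JetModel k E F) := by
  have h : ∀ m : Fin (k + 1), FiniteDimensional ℝ (E [×(m : ℕ)]→L[ℝ] F) := fun m =>
    finiteDimensional_multilinear m
  exact inferInstanceAs (FiniteDimensional ℝ (jetSubmodule k E F))

/-- A map into the jet space is smooth as soon as its components are. -/
theorem contDiffOn_jetModel {P : Type*} [NormedAddCommGroup P] [NormedSpace ℝ P]
    [FiniteDimensional ℝ E] [FiniteDimensional ℝ F] {k : ℕ} {f : P → JetModel k E F} {s : Set P}
    (h : ∀ m, ContDiffOn ℝ ∞ (fun y => (f y).1 m) s) : ContDiffOn ℝ ∞ f s := by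
  have hfin : ∀ m : Fin (k + 1), FiniteDimensional ℝ (E [×(m : ℕ)]→L[ℝ] F) := fun m =>
    finiteDimensional_multilinear m
  let ι : JetModel k E F →ₗ[ℝ] (Π m : Fin (k + 1), E [×(m : ℕ)]→L[ℝ] F) :=
    { toFun := fun T m => T.1 m, map_add' := fun _ _ => rfl, map_smul' := fun _ _ => rfl }
  have hι : Function.Injective ι := fun S T hST => JetModel.ext fun m => congrFun hST m
  obtain ⟨g, hg⟩ := LinearMap.exists_leftInverse_of_injective ι (LinearMap.ker_eq_bot.2 hι)
  have hgf : f = fun y => LinearMap.toContinuousLinearMap g (fun m => (f y).1 m) := by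
    funext y
    exact (LinearMap.congr_fun hg (f y)).symm
  rw [hgf]
  exact (contDiffOn_pi.2 h).continuousLinearMap_comp _

end Jets

section JetBundle

variable {EX : Type*} [NormedAddCommGroup EX] [NormedSpace ℝ EX]
  {X : Type*} [TopologicalSpace X] [ChartedSpace EX X]
  {F : Type*} [NormedAddCommGroup F] [NormedSpace ℝ F]
  {Y : X → Type*} [TopologicalSpace (TotalSpace F Y)] [∀ x, AddCommGroup (Y x)]
  [∀ x, Module ℝ (Y x)] [∀ x, TopologicalSpace (Y x)] [FiberBundle F Y] [VectorBundle ℝ F Y]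

variable (EX F Y) in
/-- The open set over which the preferred chart of `X` at `i` and the preferred trivialization of
`Y` at `i` are both defined. -/
def jetBaseSet (i : X) : Set X :=
  (chartAt EX i).source ∩ (trivializationAt F Y i).baseSet

/-- Change of coordinates for sections of `Y`: if `f : EX → F` represents a section in the chart
and trivialization at `i`, then `jetTransition i j f` represents it in those at `j`. -/
def jetTransition (Y : X → Type*) [TopologicalSpace (TotalSpace F Y)] [∀ x, AddCommGroup (Y x)]
    [∀ x, Module ℝ (Y x)] [∀ x, TopologicalSpace (Y x)] [FiberBundle F Y] [VectorBundle ℝ F Y]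
    (i j : X) (f : EX → F) (y : EX) : F :=
  (trivializationAt F Y i).coordChangeL ℝ (trivializationAt F Y j) ((chartAt EX j).symm y)
    (f (chartAt EX i ((chartAt EX j).symm y)))

set_option linter.unusedSectionVars false in
theorem isOpen_jetBaseSet (i : X) : IsOpen (jetBaseSet EX F Y i) :=
  (chartAt EX i).open_source.inter (trivializationAt F Y i).open_baseSet

set_option linter.unusedSectionVars false in
theorem mem_jetBaseSet (i : X) : i ∈ jetBaseSet EX F Y i :=
  ⟨mem_chart_source EX i, mem_baseSet_trivializationAt F Y i⟩

variable [IsManifold 𝓘(ℝ, EX) ∞ X]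

theorem contDiffAt_chart_transition {i j x : X} (hi : x ∈ (chartAt EX i).source)
    (hj : x ∈ (chartAt EX j).source) :
    ContDiffAt ℝ ∞ (fun y => chartAt EX i ((chartAt EX j).symm y)) (chartAt EX j x) := by
  rw [← contMDiffAt_iff_contDiffAt]
  have h1 : ContMDiffAt 𝓘(ℝ, EX) 𝓘(ℝ, EX) ∞ (chartAt EX j).symm (chartAt EX j x) :=
    (contMDiffOn_chart_symm (x := j)).contMDiffAt
      ((chartAt EX j).open_target.mem_nhds ((chartAt EX j).map_source hj))
  have h2 : ContMDiffAt 𝓘(ℝ, EX) 𝓘(ℝ, EX) ∞ (chartAt EX i) x :=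
    (contMDiffOn_chart (x := i)).contMDiffAt ((chartAt EX i).open_source.mem_nhds hi)
  rw [← (chartAt EX j).left_inv hj] at h2
  exact h2.comp _ h1

variable [ContMDiffVectorBundle ∞ F Y 𝓘(ℝ, EX)]

theorem contDiffAt_fibre_transition {i j x : X} (hi : x ∈ jetBaseSet EX F Y i)
    (hj : x ∈ jetBaseSet EX F Y j) :
    ContDiffAt ℝ ∞ (fun y => ((trivializationAt F Y i).coordChangeL ℝ (trivializationAt F Y j)
      ((chartAt EX j).symm y) : F →L[ℝ] F)) (chartAt EX j x) := by
  rw [← contMDiffAt_iff_contDiffAt]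
  have h1 : ContMDiffAt 𝓘(ℝ, EX) 𝓘(ℝ, EX) ∞ (chartAt EX j).symm (chartAt EX j x) :=
    (contMDiffOn_chart_symm (x := j)).contMDiffAt
      ((chartAt EX j).open_target.mem_nhds ((chartAt EX j).map_source hj.1))
  have h2 : ContMDiffAt 𝓘(ℝ, EX) 𝓘(ℝ, F →L[ℝ] F) ∞
      (fun b : X => ((trivializationAt F Y i).coordChangeL ℝ (trivializationAt F Y j) b :
        F →L[ℝ] F)) x := contMDiffAt_coordChangeL hi.2 hj.2
  rw [← (chartAt EX j).left_inv hj.1] at h2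
  exact h2.comp _ h1

theorem contDiffAt_jetTransition {k : ℕ} {i j x : X} (hi : x ∈ jetBaseSet EX F Y i)
    (hj : x ∈ jetBaseSet EX F Y j) {f : EX → F} (hf : ContDiffAt ℝ k f (chartAt EX i x)) :
    ContDiffAt ℝ k (jetTransition Y i j f) (chartAt EX j x) := by
  have h1 := (contDiffAt_fibre_transition hi hj).of_le
    (show (k : WithTop ℕ∞) ≤ ∞ by exact_mod_cast le_top)
  have h2 := (contDiffAt_chart_transition (EX := EX) hi.1 hj.1).of_le
    (show (k : WithTop ℕ∞) ≤ ∞ by exact_mod_cast le_top)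
  refine h1.clm_apply (ContDiffAt.comp (g := f) _ ?_ h2)
  rwa [(chartAt EX j).left_inv hj.1]

theorem jetAt_jetTransition {k : ℕ} {i j x : X} (hi : x ∈ jetBaseSet EX F Y i)
    (hj : x ∈ jetBaseSet EX F Y j) {f g : EX → F} (hf : ContDiffAt ℝ k f (chartAt EX i x))
    (hg : ContDiffAt ℝ k g (chartAt EX i x))
    (h : jetAt k f (chartAt EX i x) = jetAt k g (chartAt EX i x)) :
    jetAt k (jetTransition Y i j f) (chartAt EX j x) =
      jetAt k (jetTransition Y i j g) (chartAt EX j x) := by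
  have h1 := (contDiffAt_fibre_transition hi hj).of_le
    (show (k : WithTop ℕ∞) ≤ ∞ by exact_mod_cast le_top)
  have h2 := (contDiffAt_chart_transition (EX := EX) hi.1 hj.1).of_le
    (show (k : WithTop ℕ∞) ≤ ∞ by exact_mod_cast le_top)
  have e : chartAt EX i ((chartAt EX j).symm (chartAt EX j x)) = chartAt EX i x := by
    rw [(chartAt EX j).left_inv hj.1]
  exact jetAt_transform (ψ := fun y => chartAt EX i ((chartAt EX j).symm y))
    (by rwa [e]) (by rwa [e]) h2 h1 (by rwa [e])

variable [FiniteDimensional ℝ EX] [FiniteDimensional ℝ F]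

/-- Change of coordinates for `k`-jets at `x`, from the chart and trivialization at `i` to those
at `j`: represent a jet by its Taylor polynomial, change coordinates, and take the jet of the
result (junk value `0` outside the common domain). -/
def jetCoordChange (k : ℕ) (Y : X → Type*) [TopologicalSpace (TotalSpace F Y)]
    [∀ x, AddCommGroup (Y x)] [∀ x, Module ℝ (Y x)] [∀ x, TopologicalSpace (Y x)]
    [FiberBundle F Y] [VectorBundle ℝ F Y] [ContMDiffVectorBundle ∞ F Y 𝓘(ℝ, EX)]
    (i j x : X) : JetModel k EX F →L[ℝ] JetModel k EX F :=
  open Classical in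
  if h : x ∈ jetBaseSet EX F Y i ∩ jetBaseSet EX F Y j then
    LinearMap.toContinuousLinearMap
      { toFun := fun T =>
          jetAt k (jetTransition Y i j (jetTaylor T (chartAt EX i x))) (chartAt EX j x)
        map_add' := fun S T => by
          rw [← jetAt_add (contDiffAt_jetTransition h.1 h.2 (contDiff_jetTaylor' S _).contDiffAt)
            (contDiffAt_jetTransition h.1 h.2 (contDiff_jetTaylor' T _).contDiffAt)]
          congr 1
          funext y
          simp [jetTransition, jetTaylor_add]
        map_smul' := fun c T => by
          rw [RingHom.id_apply, ← jetAt_smul c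
            (contDiffAt_jetTransition h.1 h.2 (contDiff_jetTaylor' T _).contDiffAt)]
          congr 1
          funext y
          simp [jetTransition, jetTaylor_smul] }
  else 0

theorem jetCoordChange_apply {k : ℕ} {i j x : X} (hi : x ∈ jetBaseSet EX F Y i)
    (hj : x ∈ jetBaseSet EX F Y j) (T : JetModel k EX F) :
    jetCoordChange k Y i j x T =
      jetAt k (jetTransition Y i j (jetTaylor T (chartAt EX i x))) (chartAt EX j x) := by
  rw [jetCoordChange, dif_pos ⟨hi, hj⟩]
  rfl

/-- The change of coordinates sends the jet of a local representative to the jet of the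
transformed local representative. -/
theorem jetCoordChange_jetAt {k : ℕ} {i j x : X} (hi : x ∈ jetBaseSet EX F Y i)
    (hj : x ∈ jetBaseSet EX F Y j) {f : EX → F} (hf : ContDiffAt ℝ k f (chartAt EX i x)) :
    jetCoordChange k Y i j x (jetAt k f (chartAt EX i x)) =
      jetAt k (jetTransition Y i j f) (chartAt EX j x) := by
  rw [jetCoordChange_apply hi hj]
  exact jetAt_jetTransition hi hj (contDiff_jetTaylor' _ _).contDiffAt hf (jetAt_jetTaylor _ _)

set_option linter.unusedSectionVars false in
theorem eventually_symm_mem {j x : X} {U : Set X} (hU : IsOpen U) (hx : x ∈ U)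
    (hj : x ∈ (chartAt EX j).source) :
    ∀ᶠ y in 𝓝 (chartAt EX j x), (chartAt EX j).symm y ∈ U := by
  have h := (chartAt EX j).continuousAt_symm ((chartAt EX j).map_source hj)
  refine h.eventually_mem (hU.mem_nhds ?_)
  rwa [(chartAt EX j).left_inv hj]

theorem contMDiffOn_jetCoordChange (k : ℕ) (i j : X) :
    ContMDiffOn 𝓘(ℝ, EX) 𝓘(ℝ, JetModel k EX F →L[ℝ] JetModel k EX F) ∞
      (jetCoordChange (EX := EX) (F := F) k Y i j)
      (jetBaseSet EX F Y i ∩ jetBaseSet EX F Y j) := by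
  let V : Set EX := (chartAt EX j).target ∩
    (chartAt EX j).symm ⁻¹' (jetBaseSet EX F Y i ∩ jetBaseSet EX F Y j)
  have hV : ContDiffOn ℝ ∞
      (fun y => jetCoordChange (EX := EX) (F := F) k Y i j ((chartAt EX j).symm y)) V := by
    rw [contDiffOn_clm_apply]
    intro T
    refine contDiffOn_jetModel fun m y hy => ContDiffAt.contDiffWithinAt ?_
    obtain ⟨hyt, hyi, hyj⟩ := hy
    have hyy : chartAt EX j ((chartAt EX j).symm y) = y := (chartAt EX j).right_inv hyt
    have h1 := contDiffAt_fibre_transition hyi hyj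
    have h2 := contDiffAt_chart_transition (EX := EX) hyi.1 hyj.1
    rw [hyy] at h1 h2
    have hΦ : ContDiffAt ℝ ∞ (Function.uncurry fun (a z : EX) =>
        jetTransition Y i j (jetTaylor T (chartAt EX i ((chartAt EX j).symm a))) z) (y, y) := by
      refine ContDiffAt.clm_apply (h1.comp (y, y) contDiffAt_snd) ?_
      exact (contDiff_jetTaylor T).contDiffAt.comp (y, y)
        ((h2.comp (y, y) contDiffAt_fst).prodMk (h2.comp (y, y) contDiffAt_snd))
    have hD := ContDiffAt.comp (f := fun z : EX => (z, z)) y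
      (contDiffAt_iteratedFDeriv_param hΦ m)
      (contDiffAt_id.prodMk contDiffAt_id)
    refine hD.congr_of_eventuallyEq ?_
    filter_upwards [(chartAt EX j).open_target.mem_nhds hyt,
      (chartAt EX j).continuousAt_symm hyt |>.eventually_mem
        (((isOpen_jetBaseSet i).inter (isOpen_jetBaseSet j)).mem_nhds ⟨hyi, hyj⟩)] with z hz hz'
    rw [jetCoordChange_apply hz'.1 hz'.2, jetAt_coe
      (contDiffAt_jetTransition hz'.1 hz'.2 (contDiff_jetTaylor' T _).contDiffAt),
      (chartAt EX j).right_inv hz]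
    rfl
  have hc : ContMDiffOn 𝓘(ℝ, EX) 𝓘(ℝ, EX) ∞ (chartAt EX j)
      (jetBaseSet EX F Y i ∩ jetBaseSet EX F Y j) :=
    (contMDiffOn_chart (x := j)).mono fun x hx => hx.2.1
  have hm : Set.MapsTo (chartAt EX j) (jetBaseSet EX F Y i ∩ jetBaseSet EX F Y j) V := by
    intro x hx
    refine ⟨(chartAt EX j).map_source hx.2.1, ?_⟩
    rw [Set.mem_preimage, (chartAt EX j).left_inv hx.2.1]
    exact hx
  refine (hV.contMDiffOn.comp hc hm).congr fun x hx => ?_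
  simp only [Function.comp_apply]
  rw [(chartAt EX j).left_inv hx.2.1]

/-- The vector bundle core of the `k`-th jet bundle `J^k Y`: its typical fibre is the space of
`k`-jets of maps `EX → F`, and its transition functions are the transformation laws of the
derivatives of order `≤ k` of local representatives of sections of `Y`. -/
def jetBundleCore (EX : Type*) [NormedAddCommGroup EX] [NormedSpace ℝ EX]
    [FiniteDimensional ℝ EX] {X : Type*} [TopologicalSpace X] [ChartedSpace EX X]
    [IsManifold 𝓘(ℝ, EX) ∞ X] (k : ℕ)
    (F : Type*) [NormedAddCommGroup F] [NormedSpace ℝ F] [FiniteDimensional ℝ F]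
    (Y : X → Type*) [TopologicalSpace (TotalSpace F Y)] [∀ x, AddCommGroup (Y x)]
    [∀ x, Module ℝ (Y x)] [∀ x, TopologicalSpace (Y x)] [FiberBundle F Y] [VectorBundle ℝ F Y]
    [ContMDiffVectorBundle ∞ F Y 𝓘(ℝ, EX)] :
    VectorBundleCore ℝ X (JetModel k EX F) X where
  baseSet := jetBaseSet EX F Y
  isOpen_baseSet := isOpen_jetBaseSet
  indexAt x := x
  mem_baseSet_at := mem_jetBaseSet
  coordChange := jetCoordChange k Y
  coordChange_self i x hx T := by
    rw [jetCoordChange_apply hx hx]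
    conv_rhs => rw [← jetAt_jetTaylor T (chartAt EX i x)]
    refine jetAt_congr ?_
    filter_upwards [eventually_symm_mem (isOpen_jetBaseSet i) hx hx.1,
      (chartAt EX i).open_target.mem_nhds ((chartAt EX i).map_source hx.1)] with y hy hy'
    rw [jetTransition, Trivialization.coordChangeL_apply _ _ ⟨hy.2, hy.2⟩,
      Trivialization.apply_mk_symm _ hy.2, (chartAt EX i).right_inv hy']
  continuousOn_coordChange i j := (contMDiffOn_jetCoordChange (EX := EX) (F := F) k i j).continuousOn
  coordChange_comp i j l x hx T := by
    obtain ⟨⟨hi, hj⟩, hl⟩ := hx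
    have hT : ContDiffAt ℝ k (jetTaylor T (chartAt EX i x)) (chartAt EX i x) :=
      (contDiff_jetTaylor' T _).contDiffAt
    rw [jetCoordChange_apply hi hj, jetCoordChange_apply hi hl,
      jetCoordChange_jetAt hj hl (contDiffAt_jetTransition hi hj hT)]
    refine jetAt_congr ?_
    filter_upwards [eventually_symm_mem (isOpen_jetBaseSet i) hi hl.1,
      eventually_symm_mem (isOpen_jetBaseSet j) hj hl.1,
      eventually_symm_mem (isOpen_jetBaseSet l) hl hl.1] with y hyi hyj hyl
    simp only [jetTransition]
    rw [(chartAt EX j).left_inv hyj.1, Trivialization.coordChangeL_apply _ _ ⟨hyj.2, hyl.2⟩,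
      Trivialization.coordChangeL_apply _ _ ⟨hyi.2, hyj.2⟩,
      Trivialization.coordChangeL_apply _ _ ⟨hyi.2, hyl.2⟩]
    rw [Trivialization.symm_apply_apply_mk _ hyj.2]

/-- The `k`-th jet bundle `J^k Y → X` of a vector bundle `Y → X`. -/
abbrev JetBundle (EX : Type*) [NormedAddCommGroup EX] [NormedSpace ℝ EX]
    [FiniteDimensional ℝ EX] {X : Type*} [TopologicalSpace X] [ChartedSpace EX X]
    [IsManifold 𝓘(ℝ, EX) ∞ X] (k : ℕ)
    (F : Type*) [NormedAddCommGroup F] [NormedSpace ℝ F] [FiniteDimensional ℝ F]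
    (Y : X → Type*) [TopologicalSpace (TotalSpace F Y)] [∀ x, AddCommGroup (Y x)]
    [∀ x, Module ℝ (Y x)] [∀ x, TopologicalSpace (Y x)] [FiberBundle F Y] [VectorBundle ℝ F Y]
    [ContMDiffVectorBundle ∞ F Y 𝓘(ℝ, EX)] : X → Type _ :=
  (jetBundleCore EX k F Y).Fiber

instance jetBundleCore_isContMDiff (k : ℕ) :
    (jetBundleCore EX k F Y).IsContMDiff 𝓘(ℝ, EX) ∞ :=
  ⟨fun i j => contMDiffOn_jetCoordChange k i j⟩

instance (k : ℕ) : ContMDiffVectorBundle ∞ (JetModel k EX F) (JetBundle EX k F Y) 𝓘(ℝ, EX) :=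
  VectorBundleCore.instContMDiffVectorBundle _

/-- The local representative of a section `s` of `Y` in the preferred chart and trivialization
at `x`. -/
def localRep (F : Type*) [NormedAddCommGroup F] {Y : X → Type*}
    [TopologicalSpace (TotalSpace F Y)] [∀ x, TopologicalSpace (Y x)] [FiberBundle F Y]
    (s : ∀ x, Y x) (x : X) (y : EX) : F :=
  (trivializationAt F Y x ⟨(chartAt EX x).symm y, s ((chartAt EX x).symm y)⟩).2

/-- The `k`-jet `j^k_x s ∈ J^k_x Y` at `x` of a smooth section `s` of `Y`. -/
def sectionJet (k : ℕ) (s : Cₛ^∞⟮𝓘(ℝ, EX); F, Y⟯) (x : X) : JetBundle EX k F Y x :=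
  (jetAt k (localRep F s x) (chartAt EX x x) : JetModel k EX F)

end JetBundle

section DifferentialOperators

variable {K A P Q : Type*} [CommRing K] [CommRing A] [Algebra K A]
  [AddCommGroup P] [Module K P] [Module A P] [IsScalarTower K A P]
  [AddCommGroup Q] [Module K Q] [Module A Q] [IsScalarTower K A Q]

/-- The `K`-linear map `δ_a Φ : p ↦ a Φ(p) - Φ(a p)`. -/
def diffDelta (a : A) (Φ : P →ₗ[K] Q) : P →ₗ[K] Q where
  toFun p := a • Φ p - Φ (a • p)
  map_add' p q := by
    simp only [map_add, smul_add]; abel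
  map_smul' c p := by
    simp only [map_smul, RingHom.id_apply, smul_sub, smul_comm a c]

theorem foldr_diffDelta_zero (l : List A) : l.foldr diffDelta (0 : P →ₗ[K] Q) = 0 := by
  induction l with
  | nil => rfl
  | cons a l ih => ext p; simp [ih, diffDelta]

theorem foldr_diffDelta_add (l : List A) (Φ Ψ : P →ₗ[K] Q) :
    l.foldr diffDelta (Φ + Ψ) = l.foldr diffDelta Φ + l.foldr diffDelta Ψ := by
  induction l with
  | nil => rfl
  | cons a l ih => ext p; simp [ih, diffDelta]; abel

theorem foldr_diffDelta_smul (l : List A) (b : A) (Φ : P →ₗ[K] Q) :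
    l.foldr diffDelta (b • Φ) = b • l.foldr diffDelta Φ := by
  induction l with
  | nil => rfl
  | cons a l ih => ext p; simp [ih, diffDelta, smul_sub, smul_comm a b]

theorem foldr_diffDelta_comp (N : Submodule A P) (l : List A) (Φ : P →ₗ[K] Q) :
    l.foldr diffDelta (Φ ∘ₗ N.subtype.restrictScalars K) =
      l.foldr diffDelta Φ ∘ₗ N.subtype.restrictScalars K := by
  induction l with
  | nil => rfl
  | cons a l ih => ext p; simp [ih, diffDelta]

/-- The `A`-module `Diff_k(P, Q)` of `k`-order `Q`-valued differential operators on the `A`-module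
`P`: the `K`-linear maps `Δ : P → Q` with `δ_{a_0} (⋯ (δ_{a_k} Δ)) = 0` for every tuple
`a_0, …, a_k` of `k + 1` elements of `A`. The ring `A` acts by `(a Δ)(p) = a Δ(p)`. -/
def DiffOp (K A P Q : Type*) [CommRing K] [CommRing A] [Algebra K A]
    [AddCommGroup P] [Module K P] [Module A P] [IsScalarTower K A P]
    [AddCommGroup Q] [Module K Q] [Module A Q] [IsScalarTower K A Q] (k : ℕ) :
    Submodule A (P →ₗ[K] Q) where
  carrier := {Δ | ∀ l : List A, l.length = k + 1 → l.foldr diffDelta Δ = 0}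
  zero_mem' l _ := foldr_diffDelta_zero l
  add_mem' hΦ hΨ l hl := by rw [foldr_diffDelta_add, hΦ l hl, hΨ l hl, add_zero]
  smul_mem' b Φ hΦ l hl := by rw [foldr_diffDelta_smul, hΦ l hl, smul_zero]

/-- Restriction of differential operators from an `A`-module `P` to a submodule `N`. -/
def DiffOp.restrict (k : ℕ) (N : Submodule A P) : DiffOp K A P Q k →ₗ[A] DiffOp K A N Q k where
  toFun Δ := ⟨Δ.1 ∘ₗ N.subtype.restrictScalars K, fun l hl => by
    rw [foldr_diffDelta_comp, Δ.2 l hl, LinearMap.zero_comp]⟩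
  map_add' _ _ := rfl
  map_smul' _ _ := rfl

end DifferentialOperators

section Sections

variable {EX : Type*} [NormedAddCommGroup EX] [NormedSpace ℝ EX]
  {X : Type*} [TopologicalSpace X] [ChartedSpace EX X]
  {F : Type*} [NormedAddCommGroup F] [NormedSpace ℝ F]
  {Y : X → Type*} [TopologicalSpace (TotalSpace F Y)] [∀ x, AddCommGroup (Y x)]
  [∀ x, Module ℝ (Y x)] [∀ x, TopologicalSpace (Y x)] [FiberBundle F Y] [VectorBundle ℝ F Y]

/-- Pointwise multiplication of a smooth section by a smooth function. -/
instance sectionSMul :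
    SMul C^∞⟮𝓘(ℝ, EX), X; ℝ⟯ Cₛ^∞⟮𝓘(ℝ, EX); F, Y⟯ where
  smul f s := ⟨fun x => f x • s x, ContMDiff.smul_section f.contMDiff s.contMDiff⟩

theorem section_smul_apply (f : C^∞⟮𝓘(ℝ, EX), X; ℝ⟯) (s : Cₛ^∞⟮𝓘(ℝ, EX); F, Y⟯) (x : X) :
    (f • s) x = f x • s x := rfl

/-- The `C^∞(X)`-module structure of the space `Y(X)` of smooth global sections. -/
instance sectionModule :
    Module C^∞⟮𝓘(ℝ, EX), X; ℝ⟯ Cₛ^∞⟮𝓘(ℝ, EX); F, Y⟯ where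
  one_smul s := ContMDiffSection.ext fun x => one_smul ℝ (s x)
  mul_smul f g s := ContMDiffSection.ext fun x => mul_smul (f x) (g x) (s x)
  smul_zero f := ContMDiffSection.ext fun x => smul_zero (f x)
  smul_add f s t := ContMDiffSection.ext fun x => smul_add (f x) (s x) (t x)
  add_smul f g s := ContMDiffSection.ext fun x => add_smul (f x) (g x) (s x)
  zero_smul s := ContMDiffSection.ext fun x => zero_smul ℝ (s x)

instance sectionScalarTower :
    IsScalarTower ℝ C^∞⟮𝓘(ℝ, EX), X; ℝ⟯ Cₛ^∞⟮𝓘(ℝ, EX); F, Y⟯ where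
  smul_assoc c f s := ContMDiffSection.ext fun x => smul_assoc c (f x) (s x)

/-- The `C^∞(X)`-module `𝓓(Y)` of smooth sections of `Y` with compact support. -/
def compactSections (EX F : Type*) [NormedAddCommGroup EX] [NormedSpace ℝ EX]
    [NormedAddCommGroup F] [NormedSpace ℝ F]
    {X : Type*} [TopologicalSpace X] [ChartedSpace EX X]
    (Y : X → Type*) [TopologicalSpace (TotalSpace F Y)] [∀ x, AddCommGroup (Y x)]
    [∀ x, Module ℝ (Y x)] [∀ x, TopologicalSpace (Y x)] [FiberBundle F Y] [VectorBundle ℝ F Y] :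
    Submodule C^∞⟮𝓘(ℝ, EX), X; ℝ⟯ Cₛ^∞⟮𝓘(ℝ, EX); F, Y⟯ where
  carrier := {s | IsCompact (closure {x | s x ≠ 0})}
  zero_mem' := by
    simp
  add_mem' {s t} hs ht := by
    refine (hs.union ht).of_isClosed_subset isClosed_closure ?_
    rw [← closure_union]
    refine closure_mono fun x hx => ?_
    by_contra h
    simp only [Set.mem_union, Set.mem_ofPred_eq, not_or, not_not] at h
    exact hx (by rw [ContMDiffSection.coe_add, Pi.add_apply, h.1, h.2, add_zero])
  smul_mem' f s hs := by
    refine IsCompact.of_isClosed_subset hs isClosed_closure (closure_mono fun x hx h => hx ?_)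
    rw [section_smul_apply, h, smul_zero]

end Sections

end

noncomputable section

/-! ### Taylor's formula with smooth remainder and Hadamard's lemma -/

section ParametricIntegral

variable {E F : Type*} [NormedAddCommGroup E] [NormedSpace ℝ E]
  [NormedAddCommGroup F] [NormedSpace ℝ F]

/-! The defining condition of `DiffOp` is turned into a pointwise one. Functions act on `E(X)`
through their values and `Δ` is `ℝ`-linear, so `(δ_{f_0} ⋯ δ_{f_k} Δ)(p)` at `x` equals, up to sign,
`Δ(∏ (f_i - f_i(x)) p)` at `x`. Hence `Δ` has order `k` exactly when `Δ(f_0 ⋯ f_k p)` vanishes at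
`x` whenever all the `f_i` vanish at `x`.

One direction is then Leibniz: `k + 1` factors vanishing at `x` kill the `k`-jet, so `s ↦ σ(j^k s)`
has order `k`. The other is Hadamard's lemma: a section with zero `k`-jet at `x` agrees near `x`
with a sum of products of `k + 1` functions vanishing at `x` times sections, and operators are
local. So `Δ s` at `x` depends only on the jet of `s`
(`DiffOp.apply_eq_zero_of_sectionJet_eq_zero`). Since compactly supported sections realise every
jet, this defines `σ` fibrewise, and uniquely. Smoothness of `σ` is tested on sections that are
polynomial in a chart (`contMDiff_jetHom_of_apply_sectionJet`).

All this is done over `𝓓(Y)`, and shows that `σ ↦ Δ_σ` followed by restriction is bijective.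
Restriction is therefore surjective. It is injective because, with `χ` a cutoff equal to 1 near `x`,
`s` differs from a compactly supported section by `(1 - χ)^(k+1) s`, which every operator of order
`k` kills at `x` (`DiffOp.restrict_injective`). The case of `Y(X)` follows by cancelling the
restriction. -/

theorem hasFDerivAt_intervalIntegral_of_continuous [FiniteDimensional ℝ E]
    {V : Type*} [NormedAddCommGroup V] [NormedSpace ℝ V] [CompleteSpace V] [CompleteSpace F]
    {Φ : E → ℝ → F} {Φ' : E → ℝ → V} (c : V →L[ℝ] E →L[ℝ] F)
    (hΦ : Continuous (Function.uncurry Φ)) (hΦ' : Continuous (Function.uncurry Φ'))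
    (h : ∀ y t, HasFDerivAt (fun z => Φ z t) (c (Φ' y t)) y) (a b : ℝ) (y₀ : E) :
    HasFDerivAt (fun y => ∫ t in a..b, Φ y t) (c (∫ t in a..b, Φ' y₀ t)) y₀ := by
  -- The unit ball times the interval is compact because `E` is finite-dimensional, so a constant
  -- dominates the derivative. The map `c` will be a currying isomorphism, which lets the integral
  -- of `Φ'` stay in its own space.
  obtain ⟨C, hC⟩ := ((isCompact_closedBall y₀ 1).prod (isCompact_uIcc (a := a) (b := b))
    ).exists_bound_of_continuousOn (c.continuous.comp hΦ').continuousOn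
  have c1 : ∀ y, Continuous (Φ y) := fun y => hΦ.comp (Continuous.prodMk_right y)
  have c2 : Continuous (Φ' y₀) := hΦ'.comp (Continuous.prodMk_right y₀)
  rw [← c.intervalIntegral_comp_comm (c2.intervalIntegrable _ _)]
  refine intervalIntegral.hasFDerivAt_integral_of_dominated_of_fderiv_le (𝕜 := ℝ)
    (F := Φ) (F' := fun y t => c (Φ' y t)) (bound := fun _ => C) (s := Metric.closedBall y₀ 1)
    (Metric.closedBall_mem_nhds y₀ one_pos) (Filter.Eventually.of_forall fun y =>
      (c1 y).aestronglyMeasurable) ((c1 y₀).intervalIntegrable _ _)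
    (c.continuous.comp c2).aestronglyMeasurable ?_ intervalIntegrable_const ?_
  · exact Filter.Eventually.of_forall fun t ht y hy =>
      hC (y, t) ⟨hy, Set.uIoc_subset_uIcc ht⟩
  · exact Filter.Eventually.of_forall fun t _ y _ => h y t

set_option synthInstance.maxHeartbeats 200000 in
/-- An integral of a smooth function depending smoothly on a parameter is smooth. -/
theorem contDiff_intervalIntegral [FiniteDimensional ℝ E] [CompleteSpace F]
    {Φ : E → ℝ → F} (hΦ : ContDiff ℝ ∞ (Function.uncurry Φ)) (a b : ℝ) :
    ContDiff ℝ ∞ (fun y => ∫ t in a..b, Φ y t) := by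
  have hsm : ∀ m : ℕ, ContDiff ℝ ∞ (fun q : ℝ × E => iteratedFDeriv ℝ m (fun z => Φ z q.1) q.2) :=
    fun m => contDiff_iff_contDiffAt.2 fun q =>
      contDiffAt_iteratedFDeriv_param (Φ := fun t z => Φ z t) (a := q.1) (p := q.2)
        ((hΦ.comp (contDiff_snd.prodMk contDiff_fst)).contDiffAt (x := (q.1, q.2))) m
  have hcont : ∀ m : ℕ, Continuous
      (Function.uncurry fun (y : E) (t : ℝ) => iteratedFDeriv ℝ m (fun z => Φ z t) y) := fun m =>
    (hsm m).continuous.comp continuous_swap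
  have hslice : ∀ t, ContDiff ℝ ∞ (fun z => Φ z t) := fun t =>
    hΦ.comp (contDiff_id.prodMk contDiff_const)
  -- The candidate Taylor series, obtained by differentiating under the integral sign at every
  -- order.
  let S : E → FormalMultilinearSeries ℝ E F := fun y m =>
    ∫ t in a..b, iteratedFDeriv ℝ m (fun z => Φ z t) y
  have hint : ∀ (m : ℕ) (y : E), IntervalIntegrable
      (fun t => iteratedFDeriv ℝ m (fun z => Φ z t) y) MeasureTheory.volume a b := fun m y =>
    ((hcont m).comp (Continuous.prodMk_right y)).intervalIntegrable _ _
  have hderiv : ∀ (m : ℕ) (y : E), HasFDerivAt (fun y => S y m) (S y (m + 1)).curryLeft y := by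
    intro m y
    have hc : ∀ y t, HasFDerivAt (fun z => iteratedFDeriv ℝ m (fun z => Φ z t) z)
        (iteratedFDeriv ℝ (m + 1) (fun z => Φ z t) y).curryLeft y := fun y t => by
      have hd : DifferentiableAt ℝ (iteratedFDeriv ℝ m fun z => Φ z t) y :=
        ((hslice t).differentiable_iteratedFDeriv (by exact_mod_cast ENat.natCast_lt_top m)) y
      have e : (iteratedFDeriv ℝ (m + 1) (fun z => Φ z t) y).curryLeft =
          fderiv ℝ (iteratedFDeriv ℝ m fun z => Φ z t) y := by
        rw [iteratedFDeriv_succ_eq_comp_left]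
        exact (continuousMultilinearCurryLeftEquiv ℝ (fun _ : Fin (m + 1) => E) F).apply_symm_apply _
      rw [e]
      exact hd.hasFDerivAt
    exact hasFDerivAt_intervalIntegral_of_continuous
      (continuousMultilinearCurryLeftEquiv ℝ (fun _ : Fin (m + 1) => E) F :
        (E [×(m + 1)]→L[ℝ] F) →L[ℝ] E →L[ℝ] E [×m]→L[ℝ] F) (hcont m) (hcont (m + 1)) hc a b y
  have hS : HasFTaylorSeriesUpTo ∞ (fun y => ∫ t in a..b, Φ y t) S := by
    refine ⟨fun y => ?_, fun m _ y => hderiv m y, fun m _ =>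
      continuous_iff_continuousAt.2 fun y => (hderiv m y).continuousAt⟩
    change (∫ t in a..b, iteratedFDeriv ℝ 0 (fun z => Φ z t) y) 0 = _
    rw [← ContinuousMultilinearMap.apply_apply (𝕜 := ℝ),
      ← ContinuousLinearMap.intervalIntegral_comp_comm _ (hint 0 y)]
    simp
  exact hS.contDiff

/-- Taylor's formula with a smooth remainder. -/
theorem exists_contDiff_taylor_remainder [FiniteDimensional ℝ E] [CompleteSpace F] {f : E → F}
    (hf : ContDiff ℝ ∞ f) (k : ℕ) (p : E) :
    ∃ R : E → E [×(k + 1)]→L[ℝ] F, ContDiff ℝ ∞ R ∧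
      ∀ y, f y = jetTaylor (jetAt k f p) p y + R y (fun _ => y - p) := by
  -- The integrand of the integral remainder, kept as a multilinear map before evaluation at `y -
  -- p`; the factor `1 / k!` is put back in the witness.
  let Φ : E → ℝ → E [×(k + 1)]→L[ℝ] F := fun y t =>
    (1 - t) ^ k • iteratedFDeriv ℝ (k + 1) f (p + t • (y - p))
  have hΦ : ContDiff ℝ ∞ (Function.uncurry Φ) := by
    refine ContDiff.smul ((contDiff_const.sub contDiff_snd).pow k) ?_
    refine (hf.iteratedFDeriv_right (m := ∞) (i := k + 1)
      (by exact_mod_cast le_top)).comp ?_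
    exact contDiff_const.add (contDiff_snd.smul (contDiff_fst.sub contDiff_const))
  refine ⟨fun y => (k.factorial : ℝ)⁻¹ • ∫ t in (0 : ℝ)..1, Φ y t,
    (contDiff_intervalIntegral hΦ 0 1).const_smul _, fun y => ?_⟩
  have hk : (k : WithTop ℕ∞) + 1 ≤ ∞ := by exact_mod_cast le_top
  have key := map_add_eq_sum_add_integral_iteratedFDeriv (f := f) (x := p) (y := y - p) (n := k)
    (fun t _ => (hf.of_le hk).contDiffAt)
  rw [add_sub_cancel] at key
  rw [key, Finset.sum_range]
  congr 1
  · refine Finset.sum_congr rfl fun m _ => ?_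
    rw [jetAt_coe (hf.of_le (by exact_mod_cast le_top)).contDiffAt]
  · have hint : IntervalIntegrable (Φ y) MeasureTheory.volume 0 1 :=
      (hΦ.continuous.comp (Continuous.prodMk_right y)).intervalIntegrable _ _
    rw [smul_apply]
    congr 1
    rw [← ContinuousMultilinearMap.apply_apply (𝕜 := ℝ),
      ← ContinuousLinearMap.intervalIntegral_comp_comm _ hint]
    rfl

/-- **Hadamard's lemma**: a smooth function whose derivatives of order `≤ k` vanish at `p` is a
finite sum of multiples of products of `k + 1` smooth functions vanishing at `p`. -/
theorem exists_sum_prod_smul_of_jetAt_eq_zero [FiniteDimensional ℝ E] [CompleteSpace F] {f : E → F}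
    (hf : ContDiff ℝ ∞ f) {k : ℕ} {p : E} (h : jetAt k f p = 0) :
    ∃ (ι : Type) (_ : Fintype ι) (x : ι → Fin (k + 1) → E → ℝ) (g : ι → E → F),
      (∀ r i, ContDiff ℝ ∞ (x r i)) ∧ (∀ r i, x r i p = 0) ∧ (∀ r, ContDiff ℝ ∞ (g r)) ∧
      ∀ y, f y = ∑ r, (∏ i, x r i y) • g r y := by
  obtain ⟨R, hR, hfR⟩ := exists_contDiff_taylor_remainder hf k p
  let b := Module.finBasis ℝ E
  -- The indices are words of length `k + 1` in a basis: `y - p` is expanded in each of the `k + 1`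
  -- slots of the remainder, and the coordinates of `y - p` are the factors vanishing at `p`.
  refine ⟨Fin (k + 1) → Fin (Module.finrank ℝ E), inferInstance,
    fun r i y => b.coord (r i) (y - p), fun r y => R y (fun i => b (r i)), fun r i => ?_,
    fun r i => by simp, fun r => ?_, fun y => ?_⟩
  · exact (LinearMap.toContinuousLinearMap (b.coord (r i))).contDiff.comp
      (contDiff_id.sub contDiff_const)
  · exact (ContinuousMultilinearMap.apply ℝ (fun _ : Fin (k + 1) => E) F _).contDiff.comp hR
  · have h0 : jetTaylor (jetAt k f p) p y = 0 := by
      rw [h]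
      exact Finset.sum_eq_zero fun m _ => smul_zero _
    rw [hfR y, h0, zero_add]
    conv_lhs => rw [← b.sum_repr (y - p)]
    rw [ContinuousMultilinearMap.map_sum]
    refine Finset.sum_congr rfl fun r _ => ?_
    rw [ContinuousMultilinearMap.map_smul_univ]
    rfl

end ParametricIntegral

/-! ### Order of vanishing of products -/

section Flatness

variable {E F : Type*} [NormedAddCommGroup E] [NormedSpace ℝ E]
  [NormedAddCommGroup F] [NormedSpace ℝ F]

/-- Multiplication by a function vanishing at `p` raises the order of vanishing at `p`. -/
theorem iteratedFDeriv_smul_eq_zero {N n : ℕ} {g : E → ℝ} {f : E → F} {p : E}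
    (hg : ContDiffAt ℝ N g p) (hf : ContDiffAt ℝ N f p) (hgp : g p = 0)
    (h : ∀ m < n, iteratedFDeriv ℝ m f p = 0) {m : ℕ} (hm : m < n + 1) (hmN : m ≤ N) :
    iteratedFDeriv ℝ m (fun y => g y • f y) p = 0 := by
  obtain ⟨s, hs, hso, hps⟩ := eventually_nhds_iff.1
    ((hg.eventually (by simp)).and (hf.eventually (by simp)))
  have key := (ContinuousLinearMap.lsmul ℝ ℝ : ℝ →L[ℝ] F →L[ℝ] F
    ).norm_iteratedFDerivWithin_le_of_bilinear
    (N := N) (fun y hy => (hs y hy).1.contDiffWithinAt) (fun y hy => (hs y hy).2.contDiffWithinAt)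
    hso.uniqueDiffOn hps (n := m) (by exact_mod_cast hmN)
  rw [Finset.sum_eq_zero, mul_zero, norm_le_zero_iff] at key
  · rw [← iteratedFDerivWithin_of_isOpen m hso hps]
    exact key
  · intro i hi
    -- In the Leibniz estimate at `p`, the term with no derivative on `g` contains `g p = 0`; every
    -- other term contains a derivative of `f` of order below `n`.
    rcases Nat.eq_zero_or_pos i with rfl | hi'
    · simp [hgp]
    · rw [iteratedFDerivWithin_of_isOpen (m - i) hso hps,
        h (m - i) (by have := Finset.mem_range.1 hi; omega), norm_zero, mul_zero]

/-- Each factor vanishing at `p` raises the order of vanishing by one, so `k + 1` of them exhaust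
the derivatives of order at most `k`. -/
theorem jetAt_prod_smul_eq_zero {k : ℕ} {f : E → F} {p : E} (hf : ContDiffAt ℝ k f p)
    (l : List (E → ℝ)) (hl : l.length = k + 1) (hc : ∀ g ∈ l, ContDiffAt ℝ k g p)
    (h0 : ∀ g ∈ l, g p = 0) : jetAt k (fun y => (l.map fun g => g y).prod • f y) p = 0 := by
  have key : ContDiffAt ℝ k (fun y => (l.map fun g => g y).prod • f y) p ∧
      ∀ m < l.length, m ≤ k →
        iteratedFDeriv ℝ m (fun y => (l.map fun g => g y).prod • f y) p = 0 := by
    clear hl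
    induction l with
    | nil => exact ⟨by simpa using hf, by simp⟩
    | cons g l ih =>
      obtain ⟨ih1, ih2⟩ := ih (fun u hu => hc u (List.mem_cons_of_mem _ hu))
        (fun u hu => h0 u (List.mem_cons_of_mem _ hu))
      have hg := hc g List.mem_cons_self
      have e : (fun y => ((g :: l).map fun g => g y).prod • f y) =
          fun y => g y • (l.map fun g => g y).prod • f y := by
        funext y
        simp [mul_smul]
      rw [e]
      refine ⟨hg.smul ih1, fun m hm hmk => ?_⟩
      rw [List.length_cons] at hm
      -- The minimum keeps to orders at most `k`: the functions are only assumed `C^k`, and the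
      -- induction hypothesis says nothing beyond.
      refine iteratedFDeriv_smul_eq_zero (n := min l.length (k + 1)) hg ih1
        (h0 g List.mem_cons_self) (fun j hj => ih2 j (by omega) (by omega)) (by omega) hmk
  refine JetModel.ext fun m => ?_
  rw [jetAt_coe key.1]
  exact key.2 m (by omega) (by omega)

end Flatness

/-! ### Pointwise form of the order condition -/

section DifferentialOperators

variable {EX : Type*} [NormedAddCommGroup EX] [NormedSpace ℝ EX]
  {X : Type*} [TopologicalSpace X] [ChartedSpace EX X]
  {G : Type*} [NormedAddCommGroup G] [NormedSpace ℝ G]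
  {E : X → Type*} [TopologicalSpace (TotalSpace G E)] [∀ x, AddCommGroup (E x)]
  [∀ x, Module ℝ (E x)] [∀ x, TopologicalSpace (E x)] [FiberBundle G E] [VectorBundle ℝ G E]
  {P : Type*} [AddCommGroup P] [Module ℝ P] [Module C^∞⟮𝓘(ℝ, EX), X; ℝ⟯ P]
  [IsScalarTower ℝ C^∞⟮𝓘(ℝ, EX), X; ℝ⟯ P]

/-- At the point `x` the scalar `f x` can be moved inside by `ℝ`-linearity, so `δ_f Φ` sends `p` to
`-Φ((f - f(x)) p)` there; iterate. -/
theorem foldr_diffDelta_apply (Δ : P →ₗ[ℝ] Cₛ^∞⟮𝓘(ℝ, EX); G, E⟯)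
    (l : List C^∞⟮𝓘(ℝ, EX), X; ℝ⟯) (p : P) (x : X) :
    l.foldr diffDelta Δ p x = (-1 : ℝ) ^ l.length •
      Δ ((l.map fun f => f - algebraMap ℝ C^∞⟮𝓘(ℝ, EX), X; ℝ⟯ (f x)).prod • p) x := by
  induction l generalizing p with
  | nil => simp
  | cons a l ih =>
    have h1 : (a :: l).foldr diffDelta Δ p x =
        a x • l.foldr diffDelta Δ p x - l.foldr diffDelta Δ (a • p) x := rfl
    have h2 : a x • l.foldr diffDelta Δ p x = l.foldr diffDelta Δ (a x • p) x := by
      rw [map_smul, ContMDiffSection.coe_smul, Pi.smul_apply]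
    have h3 : a x • p - a • p =
        -((a - algebraMap ℝ C^∞⟮𝓘(ℝ, EX), X; ℝ⟯ (a x)) • p) := by
      rw [sub_smul, algebraMap_smul, neg_sub]
    rw [h1, h2, ← Pi.sub_apply, ← ContMDiffSection.coe_sub, ← map_sub, h3, ih, smul_neg, map_neg,
      ContMDiffSection.coe_neg, Pi.neg_apply, smul_smul, List.map_cons, List.prod_cons,
      List.length_cons, pow_succ, mul_neg_one, neg_smul, smul_neg, mul_comm (List.prod _)]

theorem DiffOp.apply_prod_smul_eq_zero {k : ℕ} {Δ : P →ₗ[ℝ] Cₛ^∞⟮𝓘(ℝ, EX); G, E⟯}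
    (hΔ : Δ ∈ DiffOp ℝ C^∞⟮𝓘(ℝ, EX), X; ℝ⟯ P Cₛ^∞⟮𝓘(ℝ, EX); G, E⟯ k)
    {l : List C^∞⟮𝓘(ℝ, EX), X; ℝ⟯} (hl : l.length = k + 1) {x : X} (h0 : ∀ f ∈ l, f x = 0)
    (p : P) : Δ (l.prod • p) x = 0 := by
  have h := foldr_diffDelta_apply Δ l p x
  have hm : (l.map fun f => f - algebraMap ℝ C^∞⟮𝓘(ℝ, EX), X; ℝ⟯ (f x)) = l := by
    conv_rhs => rw [← List.map_id l]
    refine List.map_congr_left fun f hf => ?_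
    rw [h0 f hf, map_zero, sub_zero, id]
  rw [hΔ l hl, hm] at h
  exact (smul_eq_zero.1 h.symm).resolve_left (pow_ne_zero _ (by norm_num))

/-- Converse of `DiffOp.apply_prod_smul_eq_zero`: the formula for iterated `δ` involves only the
functions `f_i - f_i(x)`, which do vanish at `x`. -/
theorem mem_diffOp_of_apply_prod_smul_eq_zero {k : ℕ} {Δ : P →ₗ[ℝ] Cₛ^∞⟮𝓘(ℝ, EX); G, E⟯}
    (h : ∀ l : List C^∞⟮𝓘(ℝ, EX), X; ℝ⟯, l.length = k + 1 → ∀ x, (∀ f ∈ l, f x = 0) →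
      ∀ p : P, Δ (l.prod • p) x = 0) :
    Δ ∈ DiffOp ℝ C^∞⟮𝓘(ℝ, EX), X; ℝ⟯ P Cₛ^∞⟮𝓘(ℝ, EX); G, E⟯ k := by
  intro l hl
  ext p x
  rw [foldr_diffDelta_apply, h _ (by simpa using hl) x _ p, smul_zero]
  · rfl
  · intro f hf
    obtain ⟨g, -, rfl⟩ := List.mem_map.1 hf
    exact sub_self (g x)

theorem DiffOp.apply_pow_smul_eq_zero {k : ℕ} {Δ : P →ₗ[ℝ] Cₛ^∞⟮𝓘(ℝ, EX); G, E⟯}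
    (hΔ : Δ ∈ DiffOp ℝ C^∞⟮𝓘(ℝ, EX), X; ℝ⟯ P Cₛ^∞⟮𝓘(ℝ, EX); G, E⟯ k)
    {f : C^∞⟮𝓘(ℝ, EX), X; ℝ⟯} {x : X} (h0 : f x = 0) (p : P) :
    Δ (f ^ (k + 1) • p) x = 0 := by
  rw [← List.prod_replicate]
  exact DiffOp.apply_prod_smul_eq_zero hΔ List.length_replicate
    (fun g hg => by rwa [List.eq_of_mem_replicate hg]) p

end DifferentialOperators

/-! ### Cutoff functions and globalisation of germs -/

section Bump

variable {EX : Type*} [NormedAddCommGroup EX] [NormedSpace ℝ EX] [FiniteDimensional ℝ EX]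
  {X : Type*} [TopologicalSpace X] [T2Space X] [ChartedSpace EX X] [IsManifold 𝓘(ℝ, EX) ∞ X]

variable (EX) in
theorem exists_contMDiffMap_bump {x : X} {U : Set X} (hU : U ∈ 𝓝 x) :
    ∃ χ : C^∞⟮𝓘(ℝ, EX), X; ℝ⟯, (∀ᶠ y in 𝓝 x, χ y = 1) ∧ tsupport χ ⊆ U ∧
      HasCompactSupport χ := by
  obtain ⟨χ, -, hχ⟩ := (SmoothBumpFunction.nhds_basis_tsupport (I := 𝓘(ℝ, EX)) x).mem_iff.1 hU
  exact ⟨⟨χ, χ.contMDiff⟩, χ.eventuallyEq_one, hχ, χ.hasCompactSupport⟩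

theorem exists_contMDiffMap_eventuallyEq_comp_chart (x : X) {h : EX → ℝ} (hh : ContDiff ℝ ∞ h) :
    ∃ f : C^∞⟮𝓘(ℝ, EX), X; ℝ⟯, ∀ᶠ y in 𝓝 x, f y = h (chartAt EX x y) := by
  obtain ⟨χ, -⟩ := (SmoothBumpFunction.nhds_basis_tsupport (I := 𝓘(ℝ, EX)) x).ex_mem
  refine ⟨⟨fun y => χ y • h (chartAt EX x y), χ.contMDiff_smul
    (hh.contMDiff.comp_contMDiffOn contMDiffOn_chart)⟩, ?_⟩
  filter_upwards [χ.eventuallyEq_one] with y hy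
  change χ y • h (chartAt EX x y) = _
  rw [hy, Pi.one_apply, one_smul]

/-- Local representatives are smooth only near the point, whereas Hadamard's lemma is stated for
functions smooth everywhere; a bump function bridges the gap. -/
theorem exists_contDiff_eventuallyEq {F : Type*} [NormedAddCommGroup F] [NormedSpace ℝ F]
    {f : EX → F} {p : EX} (hf : ∀ᶠ y in 𝓝 p, ContDiffAt ℝ ∞ f y) :
    ∃ g : EX → F, ContDiff ℝ ∞ g ∧ g =ᶠ[𝓝 p] f := by
  obtain ⟨r, hr, hrf⟩ := Metric.nhds_basis_closedBall.mem_iff.1 hf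
  let b : ContDiffBump p := ⟨r / 2, r, by positivity, by linarith⟩
  refine ⟨fun y => b y • f y, contDiff_iff_contDiffAt.2 fun y => ?_, ?_⟩
  · by_cases hy : y ∈ Metric.closedBall p r
    · exact b.contDiffAt.smul (hrf hy)
    · refine (contDiffAt_const (c := (0 : F))).congr_of_eventuallyEq ?_
      filter_upwards [Metric.isClosed_closedBall.isOpen_compl.mem_nhds hy] with z hz
      rw [b.zero_of_le_dist (le_of_not_ge fun h => hz h), zero_smul]
  · filter_upwards [b.eventuallyEq_one] with y hy
    rw [hy, Pi.one_apply, one_smul]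

end Bump

/-! ### Compact support from a cutoff -/

section CompactSections

variable {EX : Type*} [NormedAddCommGroup EX] [NormedSpace ℝ EX]
  {X : Type*} [TopologicalSpace X] [ChartedSpace EX X]
  {F : Type*} [NormedAddCommGroup F] [NormedSpace ℝ F]
  {Y : X → Type*} [TopologicalSpace (TotalSpace F Y)] [∀ x, AddCommGroup (Y x)]
  [∀ x, Module ℝ (Y x)] [∀ x, TopologicalSpace (Y x)] [FiberBundle F Y] [VectorBundle ℝ F Y]

theorem mem_compactSections_of_tsupport {χ : C^∞⟮𝓘(ℝ, EX), X; ℝ⟯} (hχ : HasCompactSupport χ)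
    {s : Cₛ^∞⟮𝓘(ℝ, EX); F, Y⟯} (hs : ∀ y ∉ tsupport χ, s y = 0) :
    s ∈ compactSections EX F Y := by
  refine IsCompact.of_isClosed_subset hχ isClosed_closure
    (closure_minimal (fun y hy => ?_) (isClosed_tsupport _))
  by_contra h
  exact hy (hs y h)

end CompactSections

/-! ### Locality and injectivity of restriction -/

section Locality

variable {EX : Type*} [NormedAddCommGroup EX] [NormedSpace ℝ EX] [FiniteDimensional ℝ EX]
  {X : Type*} [TopologicalSpace X] [T2Space X] [ChartedSpace EX X] [IsManifold 𝓘(ℝ, EX) ∞ X]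
  {F : Type*} [NormedAddCommGroup F] [NormedSpace ℝ F]
  {Y : X → Type*} [TopologicalSpace (TotalSpace F Y)] [∀ x, AddCommGroup (Y x)]
  [∀ x, Module ℝ (Y x)] [∀ x, TopologicalSpace (Y x)] [FiberBundle F Y] [VectorBundle ℝ F Y]
  {G : Type*} [NormedAddCommGroup G] [NormedSpace ℝ G]
  {E : X → Type*} [TopologicalSpace (TotalSpace G E)] [∀ x, AddCommGroup (E x)]
  [∀ x, Module ℝ (E x)] [∀ x, TopologicalSpace (E x)] [FiberBundle G E] [VectorBundle ℝ G E]
  {k : ℕ}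

/-- Differential operators are local. -/
theorem DiffOp.apply_eq_zero_of_eventually
    {N : Submodule C^∞⟮𝓘(ℝ, EX), X; ℝ⟯ Cₛ^∞⟮𝓘(ℝ, EX); F, Y⟯}
    {Δ : N →ₗ[ℝ] Cₛ^∞⟮𝓘(ℝ, EX); G, E⟯}
    (hΔ : Δ ∈ DiffOp ℝ C^∞⟮𝓘(ℝ, EX), X; ℝ⟯ N Cₛ^∞⟮𝓘(ℝ, EX); G, E⟯ k)
    {s : N} {x : X} (hs : ∀ᶠ y in 𝓝 x, s.1 y = 0) : Δ s x = 0 := by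
  obtain ⟨χ, h1, hχ, -⟩ := exists_contMDiffMap_bump EX hs
  -- The cutoff is supported where `s` vanishes, so `χ s = 0`. Hence `s = (1 - χ)^(k+1) s`, with `1
  -- - χ` vanishing at `x`.
  have e1 : (1 - χ) • s = s := by
    refine Subtype.ext (ContMDiffSection.ext fun y => ?_)
    change (1 - χ y) • s.1 y = s.1 y
    by_cases hy : y ∈ tsupport χ
    · rw [show s.1 y = 0 from hχ hy, smul_zero]
    · rw [image_eq_zero_of_notMem_tsupport hy, sub_zero, one_smul]
  have e2 : ∀ n : ℕ, (1 - χ) ^ n • s = s := fun n => by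
    induction n with
    | zero => rw [pow_zero, one_smul]
    | succ n ih => rw [pow_succ, mul_smul, e1, ih]
  rw [← e2 (k + 1)]
  refine DiffOp.apply_pow_smul_eq_zero hΔ ?_ s
  change 1 - χ x = 0
  rw [h1.self_of_nhds, sub_self]

/-- A differential operator is determined by its values on compactly supported sections. -/
theorem DiffOp.restrict_injective : Function.Injective
    (DiffOp.restrict (K := ℝ) (A := C^∞⟮𝓘(ℝ, EX), X; ℝ⟯) (P := Cₛ^∞⟮𝓘(ℝ, EX); F, Y⟯)
      (Q := Cₛ^∞⟮𝓘(ℝ, EX); G, E⟯) k (compactSections EX F Y)) := by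
  rw [← LinearMap.ker_eq_bot, LinearMap.ker_eq_bot']
  intro Δ hΔ
  refine Subtype.ext (LinearMap.ext fun s => ContMDiffSection.ext fun x => ?_)
  obtain ⟨χ, h1, -, hχ⟩ := exists_contMDiffMap_bump EX (Filter.univ_mem (f := 𝓝 x))
  -- This splits `s` into `(1 - χ)^(k+1) s`, killed at `x` by the order condition, and `χ q s`,
  -- which has compact support and so is killed by hypothesis.
  obtain ⟨q, hq⟩ : χ ∣ 1 - (1 - χ) ^ (k + 1) := by
    simpa using sub_dvd_pow_sub_pow (1 : C^∞⟮𝓘(ℝ, EX), X; ℝ⟯) (1 - χ) (k + 1)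
  have hs : s = (1 - χ) ^ (k + 1) • s + (χ * q) • s := by
    rw [← hq, sub_smul, one_smul]
    abel
  have hmem : (χ * q) • s ∈ compactSections EX F Y := by
    refine mem_compactSections_of_tsupport hχ fun y hy => ?_
    change (χ y * q y) • s y = 0
    rw [image_eq_zero_of_notMem_tsupport hy, zero_mul, zero_smul]
  have h2 : Δ.1 ((χ * q) • s) = 0 :=
    LinearMap.congr_fun (congrArg Subtype.val hΔ) ⟨(χ * q) • s, hmem⟩
  rw [hs, map_add, h2, add_zero]
  refine DiffOp.apply_pow_smul_eq_zero Δ.2 ?_ s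
  change 1 - χ x = 0
  rw [h1.self_of_nhds, sub_self]

end Locality

/-! ### Local representatives and jets of sections -/

section LocalRep

variable {EX : Type*} [NormedAddCommGroup EX] [NormedSpace ℝ EX]
  {X : Type*} [TopologicalSpace X] [ChartedSpace EX X]
  {F : Type*} [NormedAddCommGroup F] [NormedSpace ℝ F]
  {Y : X → Type*} [TopologicalSpace (TotalSpace F Y)] [∀ x, AddCommGroup (Y x)]
  [∀ x, Module ℝ (Y x)] [∀ x, TopologicalSpace (Y x)] [FiberBundle F Y] [VectorBundle ℝ F Y]

set_option linter.unusedSectionVars false in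
theorem localRep_eventuallyEq_iff {x₀ x : X} (hx : x ∈ (chartAt EX x₀).source)
    {s : ∀ x, Y x} {g : EX → F} :
    localRep F s x₀ =ᶠ[𝓝 (chartAt EX x₀ x)] g ↔
      ∀ᶠ y in 𝓝 x, (trivializationAt F Y x₀ ⟨y, s y⟩).2 = g (chartAt EX x₀ y) := by
  have h := (chartAt EX x₀).map_nhds_eq hx
  rw [Filter.EventuallyEq, ← h, Filter.eventually_map]
  refine Filter.eventually_congr ?_
  filter_upwards [(chartAt EX x₀).open_source.mem_nhds hx] with y hy
  rw [localRep, (chartAt EX x₀).left_inv hy]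

theorem localRep_add_eventuallyEq {x₀ x : X} (hx : x ∈ jetBaseSet EX F Y x₀) (s t : ∀ x, Y x) :
    localRep F (s + t) x₀ =ᶠ[𝓝 (chartAt EX x₀ x)]
      fun y => localRep F s x₀ y + localRep F t x₀ y := by
  rw [localRep_eventuallyEq_iff hx.1]
  filter_upwards [(isOpen_jetBaseSet x₀).mem_nhds hx] with y hy
  simp only [localRep]
  rw [(chartAt EX x₀).left_inv hy.1]
  exact ((trivializationAt F Y x₀).linear ℝ hy.2).map_add _ _

theorem localRep_smul_eventuallyEq {x₀ x : X} (hx : x ∈ jetBaseSet EX F Y x₀) (f : X → ℝ)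
    (s : ∀ x, Y x) :
    localRep F (fun y => f y • s y) x₀ =ᶠ[𝓝 (chartAt EX x₀ x)]
      fun y => f ((chartAt EX x₀).symm y) • localRep F s x₀ y := by
  rw [localRep_eventuallyEq_iff hx.1]
  filter_upwards [(isOpen_jetBaseSet x₀).mem_nhds hx] with y hy
  simp only [localRep]
  rw [(chartAt EX x₀).left_inv hy.1]
  exact ((trivializationAt F Y x₀).linear ℝ hy.2).map_smul _ _

variable [IsManifold 𝓘(ℝ, EX) ∞ X]

theorem contDiffAt_comp_chart_symm {V : Type*} [NormedAddCommGroup V] [NormedSpace ℝ V]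
    {f : X → V} {x₀ x : X} (hx : x ∈ (chartAt EX x₀).source)
    (hf : ContMDiffAt 𝓘(ℝ, EX) 𝓘(ℝ, V) ∞ f x) :
    ContDiffAt ℝ ∞ (fun y => f ((chartAt EX x₀).symm y)) (chartAt EX x₀ x) := by
  rw [← contMDiffAt_iff_contDiffAt]
  have h1 : ContMDiffAt 𝓘(ℝ, EX) 𝓘(ℝ, EX) ∞ (chartAt EX x₀).symm (chartAt EX x₀ x) :=
    (contMDiffOn_chart_symm (x := x₀)).contMDiffAt
      ((chartAt EX x₀).open_target.mem_nhds ((chartAt EX x₀).map_source hx))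
  rw [← (chartAt EX x₀).left_inv hx] at hf
  exact hf.comp _ h1

variable [ContMDiffVectorBundle ∞ F Y 𝓘(ℝ, EX)]

theorem contDiffAt_localRep (s : Cₛ^∞⟮𝓘(ℝ, EX); F, Y⟯) {x₀ x : X}
    (hx : x ∈ jetBaseSet EX F Y x₀) :
    ContDiffAt ℝ ∞ (localRep F s x₀) (chartAt EX x₀ x) :=
  contDiffAt_comp_chart_symm hx.1
    (((trivializationAt F Y x₀).contMDiffAt_section_iff hx.2).1 (s.contMDiff x))

theorem contDiffAt_localRep_nat (k : ℕ) (s : Cₛ^∞⟮𝓘(ℝ, EX); F, Y⟯) {x₀ x : X}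
    (hx : x ∈ jetBaseSet EX F Y x₀) :
    ContDiffAt ℝ k (localRep F s x₀) (chartAt EX x₀ x) :=
  (contDiffAt_localRep s hx).of_le (by exact_mod_cast le_top)

/-- The supply of test sections: transport `g` to `Y` through the chart and trivialization, and cut
off inside their common domain. -/
theorem exists_compactSection_localRep_eventuallyEq [T2Space X] [FiniteDimensional ℝ EX] (x : X)
    {g : EX → F} (hg : ContDiff ℝ ∞ g) :
    ∃ s : compactSections EX F Y, localRep F s.1 x =ᶠ[𝓝 (chartAt EX x x)] g := by
  obtain ⟨χ, h1, hχU, hχ⟩ := exists_contMDiffMap_bump EX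
    ((isOpen_jetBaseSet (EX := EX) (F := F) (Y := Y) x).mem_nhds (mem_jetBaseSet x))
  have hsec : ContMDiffOn 𝓘(ℝ, EX) (𝓘(ℝ, EX).prod 𝓘(ℝ, F)) ∞
      (fun y => TotalSpace.mk' F y ((trivializationAt F Y x).symm y (g (chartAt EX x y))))
      (jetBaseSet EX F Y x) := by
    rw [(trivializationAt F Y x).contMDiffOn_section_iff (isOpen_jetBaseSet x) fun y hy => hy.2]
    refine (hg.contMDiff.comp_contMDiffOn (contMDiffOn_chart.mono fun y hy => hy.1)).congr ?_
    intro y hy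
    rw [(trivializationAt F Y x).apply_mk_symm hy.2]
    rfl
  let s : Cₛ^∞⟮𝓘(ℝ, EX); F, Y⟯ := ⟨_, ContMDiffOn.smul_section_of_tsupport
    χ.contMDiff.contMDiffOn (isOpen_jetBaseSet x) hχU hsec⟩
  have hs : ∀ y, s y = χ y • (trivializationAt F Y x).symm y (g (chartAt EX x y)) := fun y => rfl
  refine ⟨⟨s, mem_compactSections_of_tsupport hχ fun y hy => ?_⟩, ?_⟩
  · rw [hs, image_eq_zero_of_notMem_tsupport hy, zero_smul]
  · rw [localRep_eventuallyEq_iff (mem_chart_source EX x)]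
    filter_upwards [h1, (isOpen_jetBaseSet x).mem_nhds (mem_jetBaseSet (EX := EX) (F := F)
      (Y := Y) x)] with y hy hyU
    rw [hs, hy, one_smul, (trivializationAt F Y x).apply_mk_symm hyU.2]

variable [FiniteDimensional ℝ EX] [FiniteDimensional ℝ F]

/-- The `k`-jet of sections at a point, as a linear map. -/
def sectionJetL (EX F : Type*) [NormedAddCommGroup EX] [NormedSpace ℝ EX]
    [FiniteDimensional ℝ EX] [NormedAddCommGroup F] [NormedSpace ℝ F] [FiniteDimensional ℝ F]
    {X : Type*} [TopologicalSpace X] [ChartedSpace EX X] [IsManifold 𝓘(ℝ, EX) ∞ X]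
    (Y : X → Type*) [TopologicalSpace (TotalSpace F Y)] [∀ x, AddCommGroup (Y x)]
    [∀ x, Module ℝ (Y x)] [∀ x, TopologicalSpace (Y x)] [FiberBundle F Y] [VectorBundle ℝ F Y]
    [ContMDiffVectorBundle ∞ F Y 𝓘(ℝ, EX)] (k : ℕ) (x : X) :
    Cₛ^∞⟮𝓘(ℝ, EX); F, Y⟯ →ₗ[ℝ] JetBundle EX k F Y x where
  toFun s := sectionJet k s x
  map_add' s t := (jetAt_congr (localRep_add_eventuallyEq (mem_jetBaseSet x) s t)).trans
    (jetAt_add (contDiffAt_localRep_nat k s (mem_jetBaseSet x))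
      (contDiffAt_localRep_nat k t (mem_jetBaseSet x)))
  map_smul' c s := (jetAt_congr (localRep_smul_eventuallyEq (mem_jetBaseSet x)
    (fun _ => c) s)).trans (jetAt_smul c (contDiffAt_localRep_nat k s (mem_jetBaseSet x)))

/-- The coordinates of the jet of a section are the jet of its local representative. -/
theorem trivializationAt_sectionJet (k : ℕ) (s : Cₛ^∞⟮𝓘(ℝ, EX); F, Y⟯) {x₀ x : X}
    (hx : x ∈ jetBaseSet EX F Y x₀) :
    (trivializationAt (JetModel k EX F) (JetBundle EX k F Y) x₀ ⟨x, sectionJet k s x⟩).2 =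
      jetAt k (localRep F s x₀) (chartAt EX x₀ x) := by
  -- The fibre over `x` is written in the coordinates preferred at `x` itself, so trivializing at
  -- `x₀` is the jet coordinate change from `x` to `x₀`.
  have h : (trivializationAt (JetModel k EX F) (JetBundle EX k F Y) x₀ ⟨x, sectionJet k s x⟩).2 =
      jetCoordChange k Y x x₀ x (jetAt k (localRep F s x) (chartAt EX x x)) := rfl
  rw [h, jetCoordChange_jetAt (mem_jetBaseSet x) hx
    (contDiffAt_localRep_nat k s (mem_jetBaseSet x))]
  refine jetAt_congr (Filter.EventuallyEq.symm ?_)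
  rw [localRep_eventuallyEq_iff hx.1]
  filter_upwards [(isOpen_jetBaseSet x₀).mem_nhds hx,
    (isOpen_jetBaseSet (EX := EX) (F := F) (Y := Y) x).mem_nhds (mem_jetBaseSet x)] with y hy hy'
  rw [jetTransition, (chartAt EX x₀).left_inv hy.1, localRep, (chartAt EX x).left_inv hy'.1,
    Trivialization.coordChangeL_apply _ _ ⟨hy'.2, hy.2⟩,
    Trivialization.symm_apply_apply_mk _ hy'.2]

/-- Smoothness of `f` on a whole neighbourhood identifies the components of `jetAt` with derivatives
of `f` there, excluding the default value `0`. -/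
theorem contDiffAt_jetAt {f : EX → F} {p : EX} (hf : ∀ᶠ y in 𝓝 p, ContDiffAt ℝ ∞ f y) (k : ℕ) :
    ContDiffAt ℝ ∞ (fun y => jetAt k f y) p := by
  obtain ⟨s, hs, hso, hp⟩ := eventually_nhds_iff.1 hf
  refine (contDiffOn_jetModel fun m y hy => ?_).contDiffAt (hso.mem_nhds hp)
  have h1 : ContDiffAt ℝ ∞ (iteratedFDeriv ℝ m f) y :=
    (hs y hy).iteratedFDeriv_right (by exact_mod_cast le_top)
  refine ContDiffAt.contDiffWithinAt (h1.congr_of_eventuallyEq ?_)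
  filter_upwards [hso.mem_nhds hy] with z hz
  exact jetAt_coe ((hs z hz).of_le (by exact_mod_cast le_top)) m

set_option linter.unusedSectionVars false in
theorem eventually_contDiffAt_localRep (s : Cₛ^∞⟮𝓘(ℝ, EX); F, Y⟯) (x : X) :
    ∀ᶠ y in 𝓝 (chartAt EX x x), ContDiffAt ℝ ∞ (localRep F s x) y := by
  filter_upwards [eventually_symm_mem (isOpen_jetBaseSet (EX := EX) (F := F) (Y := Y) x)
    (mem_jetBaseSet x) (mem_chart_source EX x),
    (chartAt EX x).open_target.mem_nhds (mem_chart_target EX x)] with y hy hyt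
  simpa only [(chartAt EX x).right_inv hyt] using contDiffAt_localRep s hy

/-- The jet prolongation of a smooth section is smooth. -/
theorem contMDiff_sectionJet (k : ℕ) (s : Cₛ^∞⟮𝓘(ℝ, EX); F, Y⟯) :
    ContMDiff 𝓘(ℝ, EX) (𝓘(ℝ, EX).prod 𝓘(ℝ, JetModel k EX F)) ∞
      (fun x => TotalSpace.mk' (JetModel k EX F) (E := JetBundle EX k F Y) x
        (sectionJet k s x)) := by
  intro x₀
  rw [contMDiffAt_section]
  have h1 := (contDiffAt_jetAt (eventually_contDiffAt_localRep s x₀) k).contMDiffAt.comp x₀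
    (contMDiffOn_chart.contMDiffAt ((chartAt EX x₀).open_source.mem_nhds (mem_chart_source EX x₀)))
  refine h1.congr_of_eventuallyEq ?_
  filter_upwards [(isOpen_jetBaseSet (EX := EX) (F := F) (Y := Y) x₀).mem_nhds
    (mem_jetBaseSet x₀)] with x hx
  exact trivializationAt_sectionJet k s hx

theorem sectionJet_eq_of_localRep_eventuallyEq {k : ℕ} {s : Cₛ^∞⟮𝓘(ℝ, EX); F, Y⟯} {x : X}
    {g : EX → F} (h : localRep F s x =ᶠ[𝓝 (chartAt EX x x)] g) :
    sectionJet k s x = (jetAt k g (chartAt EX x x) : JetModel k EX F) :=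
  jetAt_congr h

/-- Every jet is the jet of a compactly supported section. -/
theorem exists_compactSection_sectionJet_eq [T2Space X] {k : ℕ} {x : X}
    (T : JetBundle EX k F Y x) :
    ∃ s : compactSections EX F Y, sectionJet k s.1 x = T := by
  obtain ⟨s, hs⟩ := exists_compactSection_localRep_eventuallyEq (Y := Y) x
    (contDiff_jetTaylor' (n := ∞) (show JetModel k EX F from T) (chartAt EX x x))
  exact ⟨s, (sectionJet_eq_of_localRep_eventuallyEq hs).trans (jetAt_jetTaylor _ _)⟩

/-- Leibniz read in local coordinates; this is why an operator factoring through `k`-jets has order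
`k`. -/
theorem sectionJet_prod_smul_eq_zero {k : ℕ} {l : List C^∞⟮𝓘(ℝ, EX), X; ℝ⟯}
    (hl : l.length = k + 1) {x : X} (h0 : ∀ f ∈ l, f x = 0) (s : Cₛ^∞⟮𝓘(ℝ, EX); F, Y⟯) :
    sectionJet k (l.prod • s) x = 0 := by
  let φ := chartAt EX x
  have hx : φ.symm (φ x) = x := φ.left_inv (mem_chart_source EX x)
  have e := jetAt_prod_smul_eq_zero (contDiffAt_localRep_nat k s (mem_jetBaseSet x))
    (l.map fun f y => f (φ.symm y)) (by simpa using hl)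
    (fun g hg => by
      obtain ⟨f, -, rfl⟩ := List.mem_map.1 hg
      exact (contDiffAt_comp_chart_symm (mem_chart_source EX x) f.contMDiff.contMDiffAt).of_le
        (by exact_mod_cast le_top))
    (fun g hg => by
      obtain ⟨f, hf, rfl⟩ := List.mem_map.1 hg
      change f (φ.symm (φ x)) = 0
      rw [hx, h0 f hf])
  refine (jetAt_congr ((localRep_smul_eventuallyEq (mem_jetBaseSet x) l.prod s).trans ?_)).trans e
  refine Filter.Eventually.of_forall fun y => ?_
  have hp : l.prod (φ.symm y) = (l.map fun f => f (φ.symm y)).prod := by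
    clear e hl h0
    induction l with
    | nil => rfl
    | cons a l ih => rw [List.map_cons, List.prod_cons, List.prod_cons, ← ih]; rfl
  change l.prod (φ.symm y) • _ = _
  rw [hp]
  simp only [List.map_map]
  rfl

end LocalRep

/-! ### Smoothness of families of linear maps -/

section SmoothHom

variable {EX : Type*} [NormedAddCommGroup EX] [NormedSpace ℝ EX]
  {X : Type*} [TopologicalSpace X] [ChartedSpace EX X]
  {V W : Type*} [NormedAddCommGroup V] [NormedSpace ℝ V] [FiniteDimensional ℝ V]
  [NormedAddCommGroup W] [NormedSpace ℝ W]

/-- Since `V` is finite-dimensional, a linear map is the tuple of its values on a basis. -/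
theorem contMDiffAt_clm_of_apply {M : X → V →L[ℝ] W} {x : X}
    (h : ∀ v, ContMDiffAt 𝓘(ℝ, EX) 𝓘(ℝ, W) ∞ (fun y => M y v) x) :
    ContMDiffAt 𝓘(ℝ, EX) 𝓘(ℝ, V →L[ℝ] W) ∞ M x := by
  let e₁ := ContinuousLinearEquiv.ofFinrankEq (𝕜 := ℝ)
    (Module.finrank_fin_fun ℝ (n := Module.finrank ℝ V)).symm
  let e := (e₁.arrowCongr (1 : W ≃L[ℝ] W)).trans (ContinuousLinearEquiv.piRing (Fin _))
  have h1 : ContMDiffAt 𝓘(ℝ, EX) 𝓘(ℝ, Fin (Module.finrank ℝ V) → W) ∞ (fun y => e (M y)) x :=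
    contMDiffAt_pi_space.2 fun i => h (e₁.symm (Pi.single i 1))
  have h2 := e.symm.contDiff.contMDiff.contMDiffAt.comp (n := ∞) x h1
  refine h2.congr_of_eventuallyEq (Filter.Eventually.of_forall fun y => ?_)
  exact (e.symm_apply_apply (M y)).symm

/-- If `M ∘ L` and `L` are smooth and `L` is invertible at the point, then `M` is smooth. -/
theorem contMDiffAt_clm_of_comp {M : X → V →L[ℝ] W} {L : X → V →L[ℝ] V} {x : X}
    (hML : ContMDiffAt 𝓘(ℝ, EX) 𝓘(ℝ, V →L[ℝ] W) ∞ (fun y => (M y).comp (L y)) x)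
    (hL : ContMDiffAt 𝓘(ℝ, EX) 𝓘(ℝ, V →L[ℝ] V) ∞ L x) (hx : IsUnit (L x)) :
    ContMDiffAt 𝓘(ℝ, EX) 𝓘(ℝ, V →L[ℝ] W) ∞ M x := by
  obtain ⟨u, hu⟩ := hx
  have : CompleteSpace V := FiniteDimensional.complete ℝ V
  have hinv : ContDiffAt ℝ ∞ (Ring.inverse : (V →L[ℝ] V) → V →L[ℝ] V) (L x) :=
    hu ▸ contDiffAt_ringInverse ℝ u
  have h1 : ContMDiffAt 𝓘(ℝ, EX) 𝓘(ℝ, V →L[ℝ] V) ∞ (fun y => Ring.inverse (L y)) x :=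
    hinv.contMDiffAt.comp x hL
  -- Units form an open set, so near `x` one has `M = (M ∘ L) ∘ L⁻¹`, and inversion is smooth at a
  -- unit.
  refine (hML.clm_comp h1).congr_of_eventuallyEq ?_
  filter_upwards [hL.continuousAt.eventually_mem (Units.isOpen.mem_nhds ⟨u, hu⟩)] with y hy
  obtain ⟨w, hw⟩ := hy
  rw [ContinuousLinearMap.comp_assoc, ← hw]
  have : (w : V →L[ℝ] V).comp (Ring.inverse (w : V →L[ℝ] V)) = ContinuousLinearMap.id ℝ V := by
    rw [Ring.inverse_unit]
    exact w.mul_inv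
  rw [this, ContinuousLinearMap.comp_id]

end SmoothHom

theorem contMDiffSection_sum_apply {EX : Type*} [NormedAddCommGroup EX] [NormedSpace ℝ EX]
    {X : Type*} [TopologicalSpace X] [ChartedSpace EX X]
    {F : Type*} [NormedAddCommGroup F] [NormedSpace ℝ F]
    {Y : X → Type*} [TopologicalSpace (TotalSpace F Y)] [∀ x, AddCommGroup (Y x)]
    [∀ x, Module ℝ (Y x)] [∀ x, TopologicalSpace (Y x)] [FiberBundle F Y] [VectorBundle ℝ F Y]
    {ι : Type*} (u : Finset ι) (s : ι → Cₛ^∞⟮𝓘(ℝ, EX); F, Y⟯) (x : X) :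
    (∑ i ∈ u, s i) x = ∑ i ∈ u, s i x :=
  map_sum ((Pi.evalAddMonoidHom Y x).comp (ContMDiffSection.coeAddHom 𝓘(ℝ, EX) F ∞ Y)) _ _

/-! ### Operators as homomorphisms of the jet bundle -/

section JetOperators

variable {EX : Type*} [NormedAddCommGroup EX] [NormedSpace ℝ EX] [FiniteDimensional ℝ EX]
  {X : Type*} [TopologicalSpace X] [ChartedSpace EX X] [IsManifold 𝓘(ℝ, EX) ∞ X]
  {F : Type*} [NormedAddCommGroup F] [NormedSpace ℝ F] [FiniteDimensional ℝ F]
  {Y : X → Type*} [TopologicalSpace (TotalSpace F Y)] [∀ x, AddCommGroup (Y x)]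
  [∀ x, Module ℝ (Y x)] [∀ x, TopologicalSpace (Y x)] [FiberBundle F Y] [VectorBundle ℝ F Y]
  [ContMDiffVectorBundle ∞ F Y 𝓘(ℝ, EX)]
  {G : Type*} [NormedAddCommGroup G] [NormedSpace ℝ G]
  {E : X → Type*} [TopologicalSpace (TotalSpace G E)] [∀ x, AddCommGroup (E x)]
  [∀ x, Module ℝ (E x)] [∀ x, TopologicalSpace (E x)]
  [FiberBundle G E] [VectorBundle ℝ G E] {k : ℕ}

/-- A differential operator of order `k` depends only on `k`-jets. -/
theorem DiffOp.apply_eq_zero_of_sectionJet_eq_zero [T2Space X]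
    {Δ : compactSections EX F Y →ₗ[ℝ] Cₛ^∞⟮𝓘(ℝ, EX); G, E⟯}
    (hΔ : Δ ∈ DiffOp ℝ C^∞⟮𝓘(ℝ, EX), X; ℝ⟯ (compactSections EX F Y) Cₛ^∞⟮𝓘(ℝ, EX); G, E⟯ k)
    {s : compactSections EX F Y} {x : X} (hs : sectionJet k s.1 x = 0) : Δ s x = 0 := by
  obtain ⟨f, hf, hfs⟩ := exists_contDiff_eventuallyEq (eventually_contDiffAt_localRep s.1 x)
  have hjet : jetAt k f (chartAt EX x x) = 0 := (jetAt_congr hfs).trans hs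
  have : CompleteSpace F := FiniteDimensional.complete ℝ F
  obtain ⟨ι, _, u, g, hu, hu0, hg, hfug⟩ := exists_sum_prod_smul_of_jetAt_eq_zero hf hjet
  choose c hc using fun r i => exists_contMDiffMap_eventuallyEq_comp_chart x (hu r i)
  choose t ht using fun r => exists_compactSection_localRep_eventuallyEq (Y := Y) x (hg r)
  have hc0 : ∀ r i, c r i x = 0 := fun r i => ((hc r i).self_of_nhds).trans (hu0 r i)
  -- A global section with the germ of `s` at `x`, built from Hadamard's decomposition. Each summand
  -- is killed at `x` by the order condition, and `s - w` by locality.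
  let w : compactSections EX F Y := ∑ r, (List.ofFn (c r)).prod • t r
  have hw : Δ w x = 0 := by
    have h1 : ∀ r, Δ ((List.ofFn (c r)).prod • t r) x = 0 := fun r =>
      DiffOp.apply_prod_smul_eq_zero hΔ List.length_ofFn (fun f hf => by
        obtain ⟨i, rfl⟩ := List.mem_ofFn.1 hf
        exact hc0 r i) (t r)
    have h2 : Δ w x = ∑ r, Δ ((List.ofFn (c r)).prod • t r) x := by
      rw [map_sum, contMDiffSection_sum_apply]
    rw [h2, Finset.sum_eq_zero fun r _ => h1 r]
  have hws : Δ (s - w) x = 0 := by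
    refine DiffOp.apply_eq_zero_of_eventually hΔ ?_
    have ht' := fun r => (localRep_eventuallyEq_iff (mem_chart_source EX x)).1 (ht r)
    filter_upwards [(localRep_eventuallyEq_iff (mem_chart_source EX x)).1 hfs.symm,
      Filter.eventually_all.2 ht', Filter.eventually_all.2 fun r => Filter.eventually_all.2 (hc r),
      (isOpen_jetBaseSet (EX := EX) (F := F) (Y := Y) x).mem_nhds (mem_jetBaseSet x)]
      with y hsy hty hcy hyU
    let e : Y y ≃L[ℝ] F := (trivializationAt F Y x).continuousLinearEquivAt ℝ y hyU.2
    have he : ∀ v, e v = (trivializationAt F Y x ⟨y, v⟩).2 := fun _ => rfl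
    have hwy : w.1 y = ∑ r, (∏ i, c r i y) • (t r).1 y := by
      have h1 : w.1 = ∑ r, (List.ofFn (c r)).prod • (t r).1 :=
        map_sum (compactSections EX F Y).subtype _ _
      have h2 : w.1 y = ∑ r, ((List.ofFn (c r)).prod • (t r).1) y := by
        rw [h1, contMDiffSection_sum_apply]
      rw [h2]
      refine Finset.sum_congr rfl fun r _ => ?_
      rw [section_smul_apply, List.prod_ofFn]
      congr 1
      exact map_prod ((Pi.evalMonoidHom (fun _ : X => ℝ) y).comp
        (ContMDiffMap.coeFnMonoidHom (I := 𝓘(ℝ, EX)) (I' := 𝓘(ℝ, ℝ)) (n := ∞))) _ _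
    apply e.injective
    change e (s.1 y - w.1 y) = e 0
    rw [map_sub, map_zero, hwy, map_sum, he, hsy, hfug, sub_eq_zero]
    refine Finset.sum_congr rfl fun r _ => ?_
    rw [map_smul, he, hty]
    simp only [hcy]
  rw [map_sub, ContMDiffSection.coe_sub, Pi.sub_apply, hw, sub_zero] at hws
  exact hws

variable [∀ x, IsTopologicalAddGroup (E x)] [∀ x, ContinuousSMul ℝ (E x)]

/-- The differential operator `s ↦ σ (j^k s)` defined by a section `σ` of `Hom(J^k Y, E)`. -/
def jetHomToDiffOp : Cₛ^∞⟮𝓘(ℝ, EX); JetModel k EX F →L[ℝ] G,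
      fun x : X => JetBundle EX k F Y x →L[ℝ] E x⟯ →ₗ[C^∞⟮𝓘(ℝ, EX), X; ℝ⟯]
    DiffOp ℝ C^∞⟮𝓘(ℝ, EX), X; ℝ⟯ Cₛ^∞⟮𝓘(ℝ, EX); F, Y⟯ Cₛ^∞⟮𝓘(ℝ, EX); G, E⟯ k where
  toFun σ := ⟨{
      toFun := fun s => ⟨fun x => σ x (sectionJet k s x),
        σ.contMDiff.clm_bundle_apply (contMDiff_sectionJet k s)⟩
      map_add' := fun s t => ContMDiffSection.ext fun x => by
        change σ x (sectionJetL EX F Y k x (s + t)) = _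
        rw [map_add, map_add]
        rfl
      map_smul' := fun c s => ContMDiffSection.ext fun x => by
        change σ x (sectionJetL EX F Y k x (c • s)) = _
        rw [map_smul, map_smul]
        rfl },
    mem_diffOp_of_apply_prod_smul_eq_zero fun l hl x h0 s => by
      change σ x (sectionJet k (l.prod • s) x) = 0
      rw [sectionJet_prod_smul_eq_zero hl h0, map_zero]⟩
  map_add' _ _ := rfl
  map_smul' _ _ := rfl

/-- A homomorphism of `J^k Y` to `E` is smooth if it sends jets of compactly supported sections
to smooth sections. -/
theorem contMDiff_jetHom_of_apply_sectionJet [T2Space X]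
    (σ : ∀ x, JetBundle EX k F Y x →L[ℝ] E x)
    (h : ∀ s : compactSections EX F Y, ContMDiff 𝓘(ℝ, EX) (𝓘(ℝ, EX).prod 𝓘(ℝ, G)) ∞
      (fun x => TotalSpace.mk' G x (σ x (sectionJet k s.1 x)))) :
    ContMDiff 𝓘(ℝ, EX) (𝓘(ℝ, EX).prod 𝓘(ℝ, JetModel k EX F →L[ℝ] G)) ∞
      (fun x => TotalSpace.mk' (JetModel k EX F →L[ℝ] G)
        (E := fun x : X => JetBundle EX k F Y x →L[ℝ] E x) x (σ x)) := by
  intro x₀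
  rw [contMDiffAt_hom_bundle]
  refine ⟨contMDiffAt_id, ?_⟩
  let p := chartAt EX x₀ x₀
  -- `Λ y T` is the jet at `y` of the polynomial with jet `T` at the fixed point `p`. Test sections
  -- with this polynomial representative have these jets near `x₀`, so they control `σ` only after
  -- composition with `Λ`, which must then be inverted.
  let Λ : EX → JetModel k EX F →ₗ[ℝ] JetModel k EX F := fun y =>
    { toFun := fun T => jetAt k (jetTaylor T p) y
      map_add' := fun S T => by
        rw [← jetAt_add (contDiff_jetTaylor' S _).contDiffAt (contDiff_jetTaylor' T _).contDiffAt]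
        congr 1
        funext z
        exact jetTaylor_add S T p z
      map_smul' := fun c T => by
        rw [RingHom.id_apply, ← jetAt_smul c (contDiff_jetTaylor' T _).contDiffAt]
        congr 1
        funext z
        exact jetTaylor_smul c T p z }
  let L : X → JetModel k EX F →L[ℝ] JetModel k EX F := fun x =>
    LinearMap.toContinuousLinearMap (Λ (chartAt EX x₀ x))
  have hLapp : ∀ x T, L x T = jetAt k (jetTaylor T p) (chartAt EX x₀ x) := fun _ _ => rfl
  have hchart : ContMDiffAt 𝓘(ℝ, EX) 𝓘(ℝ, EX) ∞ (chartAt EX x₀) x₀ :=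
    contMDiffOn_chart.contMDiffAt ((chartAt EX x₀).open_source.mem_nhds (mem_chart_source EX x₀))
  refine contMDiffAt_clm_of_comp (L := L) (contMDiffAt_clm_of_apply fun T => ?_)
    (contMDiffAt_clm_of_apply fun T => ?_) ?_
  · obtain ⟨s, hs⟩ := exists_compactSection_localRep_eventuallyEq (Y := Y) x₀
      (contDiff_jetTaylor' (n := ∞) T p)
    refine ((contMDiffAt_section x₀).1 (h s x₀)).congr_of_eventuallyEq ?_
    -- Representatives equal near `p` have equal germs, hence equal jets, at all points near `p`;
    -- equality at `p` alone would not give smoothness.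
    have hs' := (chartAt EX x₀).continuousAt (mem_chart_source EX x₀)
      |>.eventually (eventually_eventually_nhds.2 hs)
    filter_upwards [hs', (isOpen_jetBaseSet (EX := EX) (F := F) (Y := Y) x₀).mem_nhds
      (mem_jetBaseSet x₀), (trivializationAt G E x₀).open_baseSet.mem_nhds
      (mem_baseSet_trivializationAt G E x₀)] with x hx hxU hxE
    have hxJ : x ∈ (trivializationAt (JetModel k EX F) (JetBundle EX k F Y) x₀).baseSet := hxU
    have e1 : L x T = (trivializationAt (JetModel k EX F) (JetBundle EX k F Y) x₀
        ⟨x, sectionJet k s.1 x⟩).2 := by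
      rw [trivializationAt_sectionJet k s.1 hxU, hLapp]
      exact (jetAt_congr hx).symm
    rw [ContinuousLinearMap.comp_apply, e1, ContinuousLinearMap.inCoordinates_eq hxJ hxE]
    have e2 := ((trivializationAt (JetModel k EX F) (JetBundle EX k F Y) x₀).continuousLinearEquivAt
      ℝ x hxJ).symm_apply_apply (sectionJet k s.1 x)
    exact congrArg (fun v => (trivializationAt G E x₀ ⟨x, σ x v⟩).2) e2
  · exact (contDiffAt_jetAt (Filter.Eventually.of_forall fun y =>
      (contDiff_jetTaylor' T p).contDiffAt) k).contMDiffAt.comp x₀ hchart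
  -- The Taylor polynomial of `T` has jet `T` at its own base point.
  · have : L x₀ = 1 := by
      ext1 T
      exact (hLapp x₀ T).trans (jetAt_jetTaylor T p)
    rw [this]
    exact isUnit_one

/-- Every differential operator on compactly supported sections comes from a section of
`Hom(J^k Y, E)`. -/
theorem exists_jetHom_of_diffOp [T2Space X]
    (Δ : DiffOp ℝ C^∞⟮𝓘(ℝ, EX), X; ℝ⟯ (compactSections EX F Y) Cₛ^∞⟮𝓘(ℝ, EX); G, E⟯ k) :
    ∃ σ : Cₛ^∞⟮𝓘(ℝ, EX); JetModel k EX F →L[ℝ] G, fun x : X => JetBundle EX k F Y x →L[ℝ] E x⟯,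
      ∀ (s : compactSections EX F Y) x, Δ.1 s x = σ x (sectionJet k s.1 x) := by
  have key : ∀ x, ∃ A : JetBundle EX k F Y x →L[ℝ] E x,
      ∀ s : compactSections EX F Y, Δ.1 s x = A (sectionJet k s.1 x) := by
    intro x
    let J : compactSections EX F Y →ₗ[ℝ] JetModel k EX F :=
      sectionJetL EX F Y k x ∘ₗ (compactSections EX F Y).subtype.restrictScalars ℝ
    have hJ : ∀ s, J s = sectionJet k s.1 x := fun _ => rfl
    obtain ⟨g, hg⟩ := J.exists_rightInverse_of_surjective
      (LinearMap.range_eq_top.2 fun T => exists_compactSection_sectionJet_eq (x := x) T)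
    let ev : Cₛ^∞⟮𝓘(ℝ, EX); G, E⟯ →ₗ[ℝ] E x :=
      { toFun := fun s => s x, map_add' := fun _ _ => rfl, map_smul' := fun _ _ => rfl }
    -- Apply `Δ` to any linear choice `g` of sections with prescribed jet at `x`; the choice is
    -- immaterial because `s - g (J s)` has zero jet. Continuity is automatic in finite dimension.
    let A : JetModel k EX F →ₗ[ℝ] E x := ev ∘ₗ Δ.1 ∘ₗ g
    refine ⟨(LinearMap.toContinuousLinearMap A : JetModel k EX F →L[ℝ] E x), fun s => ?_⟩
    have h0 : Δ.1 (s - g (J s)) x = 0 := by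
      refine DiffOp.apply_eq_zero_of_sectionJet_eq_zero Δ.2 ?_
      have h1 : J (g (J s)) = J s := LinearMap.congr_fun hg (J s)
      have h2 : J (s - g (J s)) = 0 := by rw [map_sub, h1, sub_self]
      exact h2
    rw [map_sub, ContMDiffSection.coe_sub, Pi.sub_apply, sub_eq_zero] at h0
    exact h0
  choose σ hσ using key
  refine ⟨⟨σ, contMDiff_jetHom_of_apply_sectionJet σ fun s => ?_⟩, fun s x => hσ x s⟩
  simp only [← hσ]
  exact (Δ.1 s).contMDiff

/-- Injective because jets of compactly supported sections fill every fibre of `J^k Y`; surjective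
by `exists_jetHom_of_diffOp`. -/
theorem bijective_restrict_comp_jetHomToDiffOp [T2Space X] : Function.Bijective
    (DiffOp.restrict k (compactSections EX F Y) ∘ₗ
      (jetHomToDiffOp (EX := EX) (F := F) (Y := Y) (G := G) (E := E) (k := k))) := by
  constructor
  · rw [← LinearMap.ker_eq_bot, LinearMap.ker_eq_bot']
    intro σ hσ
    refine ContMDiffSection.ext fun x => ContinuousLinearMap.ext fun T => ?_
    obtain ⟨s, hs⟩ := exists_compactSection_sectionJet_eq T
    rw [← hs]
    exact congrArg (fun t : Cₛ^∞⟮𝓘(ℝ, EX); G, E⟯ => t x)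
      (LinearMap.congr_fun (congrArg Subtype.val hσ) s)
  · intro Δ
    obtain ⟨σ, hσ⟩ := exists_jetHom_of_diffOp Δ
    exact ⟨σ, Subtype.ext (LinearMap.ext fun s => ContMDiffSection.ext fun x => (hσ s x).symm)⟩

end JetOperators

end

/-! ### The three isomorphisms -/

theorem theorem130
    {EX : Type*} [NormedAddCommGroup EX] [NormedSpace ℝ EX] [FiniteDimensional ℝ EX]
    {X : Type*} [TopologicalSpace X] [T2Space X] [SecondCountableTopology X]
    [ChartedSpace EX X] [IsManifold 𝓘(ℝ, EX) ∞ X]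
    {F : Type*} [NormedAddCommGroup F] [NormedSpace ℝ F] [FiniteDimensional ℝ F]
    {Y : X → Type*} [TopologicalSpace (TotalSpace F Y)] [∀ x, AddCommGroup (Y x)]
    [∀ x, Module ℝ (Y x)] [∀ x, TopologicalSpace (Y x)] [FiberBundle F Y] [VectorBundle ℝ F Y]
    [ContMDiffVectorBundle ∞ F Y 𝓘(ℝ, EX)]
    {G : Type*} [NormedAddCommGroup G] [NormedSpace ℝ G] [FiniteDimensional ℝ G]
    {E : X → Type*} [TopologicalSpace (TotalSpace G E)] [∀ x, AddCommGroup (E x)]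
    [∀ x, Module ℝ (E x)] [∀ x, TopologicalSpace (E x)]
    [∀ x, IsTopologicalAddGroup (E x)] [∀ x, ContinuousSMul ℝ (E x)]
    [FiberBundle G E] [VectorBundle ℝ G E] [ContMDiffVectorBundle ∞ G E 𝓘(ℝ, EX)]
    (k : ℕ) :
    -- every operator on `𝓓(Y)` is the restriction of exactly one operator on `Y(X)`
    Function.Bijective
      (DiffOp.restrict (K := ℝ) (A := C^∞⟮𝓘(ℝ, EX), X; ℝ⟯) (P := Cₛ^∞⟮𝓘(ℝ, EX); F, Y⟯)
        (Q := Cₛ^∞⟮𝓘(ℝ, EX); G, E⟯) k (compactSections EX F Y)) ∧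
    -- `((J^k Y)^* ⊗ E)(X) = Hom(J^k Y, E)(X)` is isomorphic to the module of operators on `Y(X)`
    (∃ Φ : Cₛ^∞⟮𝓘(ℝ, EX); JetModel k EX F →L[ℝ] G,
          fun x : X => JetBundle EX k F Y x →L[ℝ] E x⟯ ≃ₗ[C^∞⟮𝓘(ℝ, EX), X; ℝ⟯]
        DiffOp ℝ C^∞⟮𝓘(ℝ, EX), X; ℝ⟯ Cₛ^∞⟮𝓘(ℝ, EX); F, Y⟯ Cₛ^∞⟮𝓘(ℝ, EX); G, E⟯ k,
      ∀ σ s x, (Φ σ).1 s x = σ x (sectionJet k s x)) ∧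
    -- and to the module of operators on `𝓓(Y)`
    (∃ Ψ : Cₛ^∞⟮𝓘(ℝ, EX); JetModel k EX F →L[ℝ] G,
          fun x : X => JetBundle EX k F Y x →L[ℝ] E x⟯ ≃ₗ[C^∞⟮𝓘(ℝ, EX), X; ℝ⟯]
        DiffOp ℝ C^∞⟮𝓘(ℝ, EX), X; ℝ⟯ (compactSections EX F Y) Cₛ^∞⟮𝓘(ℝ, EX); G, E⟯ k,
      ∀ σ (s : compactSections EX F Y) x, (Ψ σ).1 s x = σ x (sectionJet k s.1 x)) := by
  have hΨ := bijective_restrict_comp_jetHomToDiffOp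
    (EX := EX) (F := F) (Y := Y) (G := G) (E := E) (k := k)
  have hr := DiffOp.restrict_injective (EX := EX) (F := F) (Y := Y) (G := G) (E := E) (k := k)
  have hres : Function.Bijective
      (DiffOp.restrict (K := ℝ) (A := C^∞⟮𝓘(ℝ, EX), X; ℝ⟯) (P := Cₛ^∞⟮𝓘(ℝ, EX); F, Y⟯)
        (Q := Cₛ^∞⟮𝓘(ℝ, EX); G, E⟯) k (compactSections EX F Y)) :=
    -- An operator on `𝓓(Y)` is extended to `Y(X)` through its jet homomorphism, which makes sense
    -- on all sections.
    ⟨hr, Function.Surjective.of_comp hΨ.2⟩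
  exact ⟨hres,
    -- The composite and the restriction are bijective, hence so is `jetHomToDiffOp`.
    ⟨LinearEquiv.ofBijective jetHomToDiffOp ((Function.Bijective.of_comp_iff' hres _).1 hΨ),
      fun σ s x => rfl⟩,
    ⟨LinearEquiv.ofBijective _ hΨ, fun σ s x => rfl⟩⟩
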